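/- For probability vectors $p,q$ in $\Delta_d=\{x\in\mathbb R^d : x_i\ge 0,\ \sum_i x_i=1\}$ let $$\mathrm{JS}(p,q)=\sum_{i=1}^d\Big(p_i\log_2\frac{2p_i}{p_i+q_i}+q_i\log_2\frac{2q_i}{p_i+q_i}\Big),\qquad 0\cdot\log(\cdot):=0 .$$ An \emph{aggregate stream} for $(p,q)$ is a sequence of $2d$ elements that lists each coordinate of $p$ and each coordinate of $q$ exactly once, in an arbitrary (adversarial) order; an element consists of the name of the vector, the index $i$, and the whole value of the coordinate (a rational number, given by numerator and denominator in lowest terms). \emph{Polynomial precision with exponent $c$} means that every coordinate of $p$ and of $q$ is a rational number whose denominator in lowest terms is at most $d^c$. A \emph{streaming algorithm} is a fixed randomized random-access-machine program (arithmetic on natural numbers, indirect addressing, conditionals, loops, fair coin tosses that are seen once and must be stored to be reused) that receives $d$ and $\lceil 1/\varepsilon\rceil$ as parameters, makes one pass over the stream, and finally outputs a rational number $r$. Its \emph{space} is measured in bits, as the largest value, over all moments of the computation (the processing of each element included), of the sum, over the nonzero memory cells, of the binary length of the address plus the binary length of the contents. \textbf{Theorem.} For every $c\in\mathbb N$ and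 every $\delta>0$ there are a streaming algorithm and a constant $C>0$ such that, for all $d\ge 2$, all $0<\varepsilon\le 1/2$, all $p,q\in\Delta_d$ of polynomial precision with exponent $c$, and every aggregate stream for $(p,q)$: for all outcomes of the coin tosses the algorithm halts and uses at most $$C\cdot\frac1{\varepsilon^2}\,\log\frac1\varepsilon\,\log d$$ bits of space, and with probability at least $1-\delta$ over the coin tosses its output $r$ satisfies $$\frac{\mathrm{JS}(p,q)}{1+\varepsilon}\;\le\; r\;\le\;(1+\varepsilon)\,\mathrm{JS}(p,q).$$ -/

import Mathlib

open MeasureTheory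

namespace JSStream

/-- The Jensen--Shannon divergence (logarithms to base 2):
`∑ i, p i * log (2 p i / (p i + q i)) + q i * log (2 q i / (p i + q i))`.
A term whose leading factor is `0` is `0`. -/
noncomputable def jsDiv {d : ℕ} (p q : Fin d → ℝ) : ℝ :=
  ∑ i, (p i * Real.logb 2 (2 * p i / (p i + q i)) + q i * Real.logb 2 (2 * q i / (p i + q i)))

/-! ### A randomized random-access machine with logarithmic-cost space -/

/-- The memory: cells with addresses in `ℕ` and contents in `ℕ`, all but finitely many empty
(that is, `0`). -/
abbrev Mem := ℕ →₀ ℕ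

/-- The number of bits in use: the memory is regarded as the list of its nonzero cells, and each
of them is charged the binary length of its address plus the binary length of its contents. -/
def Mem.space (m : Mem) : ℕ := m.sum fun a v => a.size + v.size

/-- Arithmetic expressions. `read e` is the contents of the cell whose address is the value
of `e` (so indirect addressing is allowed). -/
inductive Exp where
  | lit (n : ℕ)
  | read (e : Exp)
  | add (e₁ e₂ : Exp)
  | sub (e₁ e₂ : Exp)
  | mul (e₁ e₂ : Exp)
  | div (e₁ e₂ : Exp)

/-- The value of an expression; `sub` is truncated at `0`, `div` is integer division. The values
of all subexpressions of a fixed expression have binary length at most a constant times the space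
of the memory plus one, so that not charging for them changes the space by a constant factor. -/
def Exp.eval (m : Mem) : Exp → ℕ
  | lit n => n
  | read e => m (e.eval m)
  | add e₁ e₂ => e₁.eval m + e₂.eval m
  | sub e₁ e₂ => e₁.eval m - e₂.eval m
  | mul e₁ e₂ => e₁.eval m * e₂.eval m
  | div e₁ e₂ => e₁.eval m / e₂.eval m

/-- Programs. `assign a e` stores the value of `e` in the cell with address `a`, `flip a` tosses a
fair coin and stores the result (`0` or `1`) in that cell, `cond e P Q` runs `P` if `e ≠ 0` and `Q`
otherwise, and `loop e P` repeats `P` as long as `e ≠ 0`. -/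
inductive Prog where
  | skip
  | assign (a e : Exp)
  | flip (a : Exp)
  | seq (P Q : Prog)
  | cond (e : Exp) (P Q : Prog)
  | loop (e : Exp) (P : Prog)

/-- A configuration: the memory, and the results of the coin tosses still to come. The machine
sees a coin only when it tosses it, and has to store the result if it wants to use it again. -/
structure Config where
  mem : Mem
  coins : ℕ → Bool

/-- `Run S P c c'`: started in the configuration `c`, the program `P` halts in the configuration
`c'`, and at every moment from the start to the end the memory takes at most `S` bits. -/
inductive Run (S : ℝ) : Prog → Config → Config → Prop
  | skip {c : Config} (h : (c.mem.space : ℝ) ≤ S) : Run S .skip c c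
  | assign {a e : Exp} {c c' : Config} (h : (c.mem.space : ℝ) ≤ S)
      (hc' : c' = ⟨c.mem.update (a.eval c.mem) (e.eval c.mem), c.coins⟩)
      (h' : (c'.mem.space : ℝ) ≤ S) : Run S (.assign a e) c c'
  | flip {a : Exp} {c c' : Config} (h : (c.mem.space : ℝ) ≤ S)
      (hc' : c' = ⟨c.mem.update (a.eval c.mem) (c.coins 0).toNat, fun n => c.coins (n + 1)⟩)
      (h' : (c'.mem.space : ℝ) ≤ S) : Run S (.flip a) c c'
  | seq {P Q : Prog} {c c' c'' : Config} (hP : Run S P c c') (hQ : Run S Q c' c'') :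
      Run S (.seq P Q) c c''
  | cond_true {e : Exp} {P Q : Prog} {c c' : Config} (he : e.eval c.mem ≠ 0)
      (hP : Run S P c c') : Run S (.cond e P Q) c c'
  | cond_false {e : Exp} {P Q : Prog} {c c' : Config} (he : e.eval c.mem = 0)
      (hQ : Run S Q c c') : Run S (.cond e P Q) c c'
  | loop_true {e : Exp} {P : Prog} {c c' c'' : Config} (he : e.eval c.mem ≠ 0)
      (hP : Run S P c c') (hloop : Run S (.loop e P) c' c'') : Run S (.loop e P) c c''
  | loop_false {e : Exp} {P : Prog} {c : Config} (he : e.eval c.mem = 0)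
      (h : (c.mem.space : ℝ) ≤ S) : Run S (.loop e P) c c

/-! ### Aggregate streams and streaming algorithms -/

/-- A stream element: it says that coordinate `index` of the first vector (`second = false`) or of
the second vector (`second = true`) equals `value`. -/
structure Item (d : ℕ) where
  second : Bool
  index : Fin d
  value : ℚ

/-- `l` is an aggregate stream for the pair `(p, q)`: it lists every coordinate of `p` and every
coordinate of `q` exactly once, each in its entirety, in an arbitrary order. -/
def IsAggregateStream {d : ℕ} (p q : Fin d → ℚ) (l : List (Item d)) : Prop :=
  l.Perm ((List.finRange d).map (fun i => ⟨false, i, p i⟩) ++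
    (List.finRange d).map (fun i => ⟨true, i, q i⟩))

/-- A streaming algorithm: a program that is run before the stream, one that is run on each
stream element, and one that is run after the stream. -/
structure Algorithm where
  init : Prog
  update : Prog
  finish : Prog

/-- The memory at the start holds the two parameters, in the cells `0` and `1`. -/
noncomputable def startMem (d k : ℕ) : Mem := Finsupp.single 0 d + Finsupp.single 1 k

/-- The arrival of a stream element overwrites the cells `0, 1, 2, 3` with the vector concerned
(`0` or `1`), the index, and the numerator and denominator of the (nonnegative) value in lowest
terms. -/
noncomputable def Item.load {d : ℕ} (x : Item d) (m : Mem) : Mem :=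
  (((m.update 0 x.second.toNat).update 1 x.index).update 2 x.value.num.natAbs).update 3 x.value.den

/-- One pass of the program `P` over a stream, within space `S`. -/
inductive Pass (S : ℝ) (P : Prog) {d : ℕ} : List (Item d) → Config → Config → Prop
  | nil {c : Config} : Pass S P [] c c
  | cons {x : Item d} {l : List (Item d)} {c c' c'' : Config}
      (hx : Run S P ⟨x.load c.mem, c.coins⟩ c') (hl : Pass S P l c' c'') : Pass S P (x :: l) c c''

/-- `A.Outputs S k l ω r`: with parameters `d` and `k`, on the stream `l` and with coin tosses `ω`,
the algorithm halts, never uses more than `S` bits of memory, and outputs the rational number `r`,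
whose numerator and denominator it leaves in the cells `0` and `1`. -/
def Algorithm.Outputs (A : Algorithm) (S : ℝ) {d : ℕ} (k : ℕ) (l : List (Item d)) (ω : ℕ → Bool)
    (r : ℚ) : Prop :=
  ∃ c₁ c₂ c₃ : Config, Run S A.init ⟨startMem d k, ω⟩ c₁ ∧ Pass S A.update l c₁ c₂ ∧
    Run S A.finish c₂ c₃ ∧ c₃.mem 1 ≠ 0 ∧ r = (c₃.mem 0 : ℚ) / (c₃.mem 1 : ℚ)

/-- The law of an infinite sequence of independent fair coin tosses. -/
noncomputable def coinMeasure : Measure (ℕ → Bool) :=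
  Measure.infinitePi fun _ => (PMF.uniformOfFintype Bool).toMeasure

end JSStream

namespace JSStream

/-! ### Harmonic sums and the Hilbert kernel -/

/-- `n * H n`, a discrete analogue of `t * log t`. -/
noncomputable def harmonicMul (n : ℕ) : ℝ := n * (harmonic n : ℝ)

/-- The sum of the Hilbert kernel `1 / (k + l + 1)` over the square `[X, Y)²`. -/
noncomputable def hilbertSum (X Y : ℕ) : ℝ :=
  ∑ k ∈ Finset.Ico X Y, ∑ l ∈ Finset.Ico X Y, 1 / ((k : ℝ) + l + 1)

/-- The continuous analogue of `hilbertSum`, the integral of `1 / (u + v)` over `[a, b]²`. -/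
noncomputable def logKernel (a b : ℝ) : ℝ :=
  2 * a * Real.log (2 * a) + 2 * b * Real.log (2 * b) - 2 * ((a + b) * Real.log (a + b))

lemma harmonicMul_second_difference (n : ℕ) :
    harmonicMul (n + 2) - 2 * harmonicMul (n + 1) + harmonicMul n = 1 / ((n : ℝ) + 1) := by
  unfold harmonicMul
  rw [harmonic_succ (n + 1), harmonic_succ n]
  push_cast
  have h1 : (n : ℝ) + 1 ≠ 0 := by positivity
  have h2 : (n : ℝ) + 1 + 1 ≠ 0 := by positivity
  field_simp
  ring

lemma hilbertSum_eq {X Y : ℕ} (h : X ≤ Y) :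
    hilbertSum X Y = harmonicMul (2 * X) + harmonicMul (2 * Y) - 2 * harmonicMul (X + Y) := by
  have inner (k : ℕ) : ∑ l ∈ Finset.Ico X Y, 1 / ((k : ℝ) + l + 1) =
      (harmonicMul (k + Y + 1) - harmonicMul (k + Y)) -
        (harmonicMul (k + X + 1) - harmonicMul (k + X)) := by
    rw [← Finset.sum_Ico_sub (fun l => harmonicMul (k + l + 1) - harmonicMul (k + l)) h]
    refine Finset.sum_congr rfl fun l _ => ?_
    have := harmonicMul_second_difference (k + l)
    push_cast at this
    rw [← this]
    simp only [← add_assoc]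
    ring
  unfold hilbertSum
  simp_rw [inner]
  have e := Finset.sum_Ico_sub (fun k => harmonicMul (k + Y) - harmonicMul (k + X)) h
  have : ∑ k ∈ Finset.Ico X Y, ((harmonicMul (k + Y + 1) - harmonicMul (k + Y)) -
        (harmonicMul (k + X + 1) - harmonicMul (k + X))) =
      ∑ k ∈ Finset.Ico X Y, ((harmonicMul (k + 1 + Y) - harmonicMul (k + 1 + X)) -
        (harmonicMul (k + Y) - harmonicMul (k + X))) := by
    refine Finset.sum_congr rfl fun k _ => ?_
    rw [show k + 1 + Y = k + Y + 1 by ring, show k + 1 + X = k + X + 1 by ring]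
    ring
  rw [this, e, two_mul, two_mul, add_comm Y X]
  ring

lemma abs_harmonicMul_sub_le (n : ℕ) :
    |harmonicMul n - Real.eulerMascheroniConstant * n - n * Real.log n| ≤ 1 := by
  rcases Nat.eq_zero_or_pos n with rfl | hn
  · simp [harmonicMul]
  have hn' : (0 : ℝ) < n := by exact_mod_cast hn
  have h1 := Real.eulerMascheroniSeq_lt_eulerMascheroniConstant n
  have h2 := Real.eulerMascheroniConstant_lt_eulerMascheroniSeq' n
  unfold Real.eulerMascheroniSeq at h1
  unfold Real.eulerMascheroniSeq' at h2
  rw [if_neg hn.ne'] at h2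
  have h3 : Real.log (n + 1) ≤ Real.log n + 1 / n := by
    have := Real.log_le_sub_one_of_pos (x := ((n : ℝ) + 1) / n) (by positivity)
    rw [Real.log_div (by positivity) hn'.ne'] at this
    have e : ((n : ℝ) + 1) / n - 1 = 1 / n := by field_simp; ring
    linarith
  have e : harmonicMul n - Real.eulerMascheroniConstant * n - n * Real.log n =
      n * ((harmonic n : ℝ) - Real.log n - Real.eulerMascheroniConstant) := by
    unfold harmonicMul; ring
  rw [e, abs_mul, abs_of_pos hn', abs_of_pos (by linarith)]
  calc (n : ℝ) * ((harmonic n : ℝ) - Real.log n - Real.eulerMascheroniConstant)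
      ≤ n * (1 / n) := by gcongr; linarith
    _ = 1 := by field_simp

lemma abs_hilbertSum_sub_logKernel_le {X Y : ℕ} (h : X ≤ Y) :
    |hilbertSum X Y - logKernel X Y| ≤ 4 := by
  have h1 := abs_le.1 (abs_harmonicMul_sub_le (2 * X))
  have h2 := abs_le.1 (abs_harmonicMul_sub_le (2 * Y))
  have h3 := abs_le.1 (abs_harmonicMul_sub_le (X + Y))
  push_cast at h1 h2 h3
  rw [hilbertSum_eq h, abs_le]
  unfold logKernel
  constructor <;> nlinarith

lemma abs_mul_log_sub_le {s t : ℝ} (hs : 0 ≤ s) (hst : s ≤ t) (ht : t ≤ s + 2) :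
    |t * Real.log t - s * Real.log s| ≤ 7 + 4 * √t := by
  have ht0 : 0 ≤ t := hs.trans hst
  have hq : 0 ≤ √t := Real.sqrt_nonneg t
  rcases lt_or_ge s 1 with h1 | h1
  · have up {u : ℝ} (h0 : 0 ≤ u) : u * Real.log u ≤ u * (u - 1) := by
      rcases h0.eq_or_lt with rfl | h0
      · simp
      · exact mul_le_mul_of_nonneg_left (Real.log_le_sub_one_of_pos h0) h0.le
    have lo {u : ℝ} (h0 : 0 ≤ u) : u - 1 ≤ u * Real.log u := by
      rcases h0.eq_or_lt with rfl | h0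
      · simp
      · have := Real.one_sub_inv_le_log_of_pos h0
        have := mul_le_mul_of_nonneg_left this h0.le
        rwa [mul_sub, mul_inv_cancel₀ h0.ne', mul_one] at this
    have a1 := up hs; have a2 := up ht0; have a3 := lo hs; have a4 := lo ht0
    rw [abs_le]; constructor <;> nlinarith
  · have hs0 : 0 < s := by linarith
    have ht1 : 0 < t := by linarith
    have l1 : Real.log t ≤ 2 * √t := by
      have := Real.log_le_sub_one_of_pos (Real.sqrt_pos.2 ht1)
      rw [Real.log_sqrt ht0] at this
      linarith
    have l2 : s * (Real.log t - Real.log s) ≤ t - s := by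
      have := Real.log_le_sub_one_of_pos (div_pos ht1 hs0)
      rw [Real.log_div ht1.ne' hs0.ne'] at this
      calc s * (Real.log t - Real.log s) ≤ s * (t / s - 1) := by gcongr
        _ = t - s := by field_simp
    have l3 : 0 ≤ Real.log t - Real.log s := sub_nonneg.2 (Real.log_le_log hs0 hst)
    have l4 : 0 ≤ Real.log t := Real.log_nonneg (h1.trans hst)
    have e : t * Real.log t - s * Real.log s =
      (t - s) * Real.log t + s * (Real.log t - Real.log s) := by ring
    rw [e, abs_of_nonneg (by have := mul_nonneg (sub_nonneg.2 hst) l4; have := mul_nonneg hs l3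
                             linarith)]
    nlinarith

lemma abs_logKernel_sub_floor_le {a b M : ℝ} (ha : 0 ≤ a) (hb : 0 ≤ b) (haM : a ≤ M) (hbM : b ≤ M)
    (hM : 1 ≤ M) : |logKernel a b - logKernel ⌊a⌋₊ ⌊b⌋₊| ≤ 53 * √M := by
  have a1 := Nat.floor_le ha
  have a2 := Nat.lt_floor_add_one a
  have b1 := Nat.floor_le hb
  have b2 := Nat.lt_floor_add_one b
  have hq : 1 ≤ √M := Real.one_le_sqrt.2 hM
  have hsq : ∀ t, t ≤ 2 * M → √t ≤ 3 / 2 * √M := fun t ht => by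
    rw [Real.sqrt_le_left (by positivity), mul_pow, Real.sq_sqrt (by linarith)]
    linarith
  have i1 := abs_mul_log_sub_le (s := 2 * (⌊a⌋₊ : ℝ)) (t := 2 * a) (by positivity) (by linarith)
    (by linarith)
  have i2 := abs_mul_log_sub_le (s := 2 * (⌊b⌋₊ : ℝ)) (t := 2 * b) (by positivity) (by linarith)
    (by linarith)
  have i3 := abs_mul_log_sub_le (s := (⌊a⌋₊ : ℝ) + ⌊b⌋₊) (t := a + b) (by positivity) (by linarith)
    (by linarith)
  have j1 := hsq (2 * a) (by linarith)
  have j2 := hsq (2 * b) (by linarith)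
  have j3 := hsq (a + b) (by linarith)
  rw [abs_le] at i1 i2 i3 ⊢
  unfold logKernel
  constructor <;> linarith

/-! ### The discretized power functions -/

/-- An integer approximation of `B * (j / N) ^ k`. -/
def powApprox (B N j : ℕ) : ℕ → ℕ
  | 0 => B
  | k + 1 => powApprox B N j k * j / N

/-- The `j`-th coordinate of the embedding of `X`. -/
def embed (B N j X : ℕ) : ℕ := ∑ k ∈ Finset.range X, powApprox B N j k

lemma powApprox_le {B N j : ℕ} (hj : j < N) (k : ℕ) : powApprox B N j k ≤ B := by
  induction k with
  | zero => exact le_rfl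
  | succ k ih =>
    exact (Nat.div_le_of_le_mul (by rw [mul_comm N]; gcongr)).trans ih

lemma embed_le {B N j : ℕ} (hj : j < N) (X : ℕ) : embed B N j X ≤ B * X := by
  unfold embed
  refine (Finset.sum_le_card_nsmul _ _ B fun k _ => powApprox_le hj k).trans ?_
  simp [mul_comm]

lemma powApprox_le_pow (B : ℕ) {N j : ℕ} (k : ℕ) :
    (powApprox B N j k : ℝ) ≤ B * ((j : ℝ) / N) ^ k := by
  induction k with
  | zero => simp [powApprox]
  | succ k ih =>
    calc (powApprox B N j (k + 1) : ℝ) ≤ ((powApprox B N j k * j : ℕ) : ℝ) / N := Nat.cast_div_le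
      _ = powApprox B N j k * ((j : ℝ) / N) := by push_cast; ring
      _ ≤ B * ((j : ℝ) / N) ^ k * ((j : ℝ) / N) := by gcongr
      _ = _ := by ring

lemma pow_le_powApprox_add (B : ℕ) {N j : ℕ} (hj : j < N) (k : ℕ) :
    B * ((j : ℝ) / N) ^ k ≤ powApprox B N j k + k := by
  have hN : (0 : ℝ) < N := by exact_mod_cast (Nat.zero_le j).trans_lt hj
  have ht : (j : ℝ) / N ≤ 1 := by
    rw [div_le_one hN]; exact_mod_cast hj.le
  induction k with
  | zero => simp [powApprox]
  | succ k ih =>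
    have h1 : (powApprox B N j k * j : ℝ) / N ≤ powApprox B N j (k + 1) + 1 := by
      have := Nat.lt_div_mul_add (a := powApprox B N j k * j) (b := N) (by exact_mod_cast hN)
      rw [div_le_iff₀ hN, add_mul, one_mul]
      exact_mod_cast this.le
    calc (B : ℝ) * ((j : ℝ) / N) ^ (k + 1) = B * ((j : ℝ) / N) ^ k * ((j : ℝ) / N) := by ring
      _ ≤ (powApprox B N j k + k) * ((j : ℝ) / N) := by gcongr
      _ = (powApprox B N j k * j : ℝ) / N + k * ((j : ℝ) / N) := by ring
      _ ≤ (powApprox B N j (k + 1) + 1) + k * 1 := by gcongr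
      _ = _ := by push_cast; ring

lemma sum_pow_mul_le (n N : ℕ) : (n + 1) * ∑ j ∈ Finset.range N, (j : ℝ) ^ n ≤ (N : ℝ) ^ (n + 1) ∧
    (N : ℝ) ^ (n + 1) ≤ (n + 1) * (∑ j ∈ Finset.range N, (j : ℝ) ^ n + (N : ℝ) ^ n) := by
  induction N with
  | zero => exact ⟨by simp, by simp; positivity⟩
  | succ N ih =>
    have hN : (0 : ℝ) ≤ N := Nat.cast_nonneg N
    have e : ((N : ℝ) + 1) ^ (n + 1) - (N : ℝ) ^ (n + 1) =
        ∑ i ∈ Finset.range (n + 1), ((N : ℝ) + 1) ^ i * (N : ℝ) ^ (n - i) := by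
      have := (Commute.all ((N : ℝ) + 1) (N : ℝ)).geom_sum₂_mul (n + 1)
      simpa using this.symm
    have l1 : (n + 1) * (N : ℝ) ^ n ≤
        ∑ i ∈ Finset.range (n + 1), ((N : ℝ) + 1) ^ i * (N : ℝ) ^ (n - i) := by
      have : ∀ i ∈ Finset.range (n + 1), (N : ℝ) ^ n ≤ ((N : ℝ) + 1) ^ i * (N : ℝ) ^ (n - i) := by
        intro i hi
        have hi' : i ≤ n := Nat.lt_succ_iff.1 (Finset.mem_range.1 hi)
        calc (N : ℝ) ^ n = (N : ℝ) ^ i * (N : ℝ) ^ (n - i) := by rw [← pow_add]; congr 1; omega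
          _ ≤ _ := by gcongr; linarith
      simpa using Finset.card_nsmul_le_sum _ _ _ this
    have l2 : ∑ i ∈ Finset.range (n + 1), ((N : ℝ) + 1) ^ i * (N : ℝ) ^ (n - i) ≤
        (n + 1) * ((N : ℝ) + 1) ^ n := by
      have : ∀ i ∈ Finset.range (n + 1), ((N : ℝ) + 1) ^ i * (N : ℝ) ^ (n - i) ≤
          ((N : ℝ) + 1) ^ n := by
        intro i hi
        have hi' : i ≤ n := Nat.lt_succ_iff.1 (Finset.mem_range.1 hi)
        calc _ ≤ ((N : ℝ) + 1) ^ i * ((N : ℝ) + 1) ^ (n - i) := by gcongr; linarith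
          _ = _ := by rw [← pow_add]; congr 1; omega
      simpa using Finset.sum_le_card_nsmul _ _ _ this
    rw [Finset.sum_range_succ]
    push_cast
    constructor <;> nlinarith [ih.1, ih.2]

lemma abs_riemann_sum_pow_le {N : ℕ} (hN : 0 < N) (n : ℕ) :
    |∑ j ∈ Finset.range N, ((j : ℝ) / N) ^ n - N / ((n : ℝ) + 1)| ≤ 1 := by
  obtain ⟨h1, h2⟩ := sum_pow_mul_le n N
  have hN' : (0 : ℝ) < N := by exact_mod_cast hN
  simp_rw [div_pow, ← Finset.sum_div]
  set s := ∑ j ∈ Finset.range N, (j : ℝ) ^ n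
  have hp : (0 : ℝ) < (N : ℝ) ^ n := by positivity
  have hn : (0 : ℝ) < (n : ℝ) + 1 := by positivity
  have e : s / (N : ℝ) ^ n - N / ((n : ℝ) + 1) =
      ((n + 1) * s - (N : ℝ) ^ (n + 1)) / ((n + 1) * (N : ℝ) ^ n) := by
    field_simp
    ring
  rw [e, abs_div, abs_of_pos (mul_pos hn hp), div_le_one (mul_pos hn hp), abs_le]
  have := mul_pos hn hp
  constructor <;> nlinarith

lemma abs_sum_powApprox_mul_le (B : ℕ) {N : ℕ} (hN : 0 < N) (k l : ℕ) :
    |∑ j ∈ Finset.range N, (powApprox B N j k : ℝ) * powApprox B N j l -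
      (B : ℝ) ^ 2 * N * (1 / ((k : ℝ) + l + 1))| ≤ (B : ℝ) ^ 2 + N * (B * (k + l)) := by
  have h1 := abs_riemann_sum_pow_le hN (k + l)
  have h2 : |∑ j ∈ Finset.range N, (powApprox B N j k : ℝ) * powApprox B N j l -
      ∑ j ∈ Finset.range N, (B : ℝ) ^ 2 * ((j : ℝ) / N) ^ (k + l)| ≤ N * (B * (k + l)) := by
    rw [← Finset.sum_sub_distrib]
    refine (Finset.abs_sum_le_sum_abs _ _).trans ?_
    have : ∀ j ∈ Finset.range N, |(powApprox B N j k : ℝ) * powApprox B N j l -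
        (B : ℝ) ^ 2 * ((j : ℝ) / N) ^ (k + l)| ≤ B * (k + l) := by
      intro j hj
      have hj := Finset.mem_range.1 hj
      have a1 := powApprox_le_pow B (N := N) (j := j) k
      have a2 := pow_le_powApprox_add B hj k
      have b1 := powApprox_le_pow B (N := N) (j := j) l
      have b2 := pow_le_powApprox_add B hj l
      have a3 : (powApprox B N j k : ℝ) ≤ B := by exact_mod_cast powApprox_le hj k
      have b3 : (B : ℝ) * ((j : ℝ) / N) ^ l ≤ B := by
        have : ((j : ℝ) / N) ^ l ≤ 1 := pow_le_one₀ (by positivity)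
          (div_le_one_of_le₀ (by exact_mod_cast hj.le) (by positivity))
        have hB : (0 : ℝ) ≤ B := Nat.cast_nonneg B
        nlinarith
      have e : (B : ℝ) ^ 2 * ((j : ℝ) / N) ^ (k + l) =
          (B * ((j : ℝ) / N) ^ k) * (B * ((j : ℝ) / N) ^ l) := by rw [pow_add]; ring
      rw [e]
      have c1 : (0 : ℝ) ≤ powApprox B N j k := Nat.cast_nonneg _
      have c2 : (0 : ℝ) ≤ B * ((j : ℝ) / N) ^ l := by positivity
      have c3 : (0 : ℝ) ≤ k := Nat.cast_nonneg _
      have c4 : (0 : ℝ) ≤ l := Nat.cast_nonneg _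
      rw [abs_le]
      constructor <;> nlinarith
    simpa using Finset.sum_le_card_nsmul _ _ _ this
  rw [← Finset.mul_sum] at h2
  have h3 : |(B : ℝ) ^ 2 * ∑ j ∈ Finset.range N, ((j : ℝ) / N) ^ (k + l) -
      (B : ℝ) ^ 2 * N * (1 / ((k : ℝ) + l + 1))| ≤ (B : ℝ) ^ 2 := by
    have e : (B : ℝ) ^ 2 * ∑ j ∈ Finset.range N, ((j : ℝ) / N) ^ (k + l) -
      (B : ℝ) ^ 2 * N * (1 / ((k : ℝ) + l + 1)) = (B : ℝ) ^ 2 *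
      (∑ j ∈ Finset.range N, ((j : ℝ) / N) ^ (k + l) - N / (((k + l : ℕ) : ℝ) + 1)) := by
      push_cast; ring
    rw [e, abs_mul, abs_of_nonneg (by positivity : (0 : ℝ) ≤ (B : ℝ) ^ 2)]
    exact mul_le_of_le_one_right (by positivity) h1
  calc _ ≤ _ := abs_sub_le _ ((B : ℝ) ^ 2 * ∑ j ∈ Finset.range N, ((j : ℝ) / N) ^ (k + l)) _
    _ ≤ _ := by linarith

/-- The squared distance of the embeddings of `X` and `Y`. -/
noncomputable def embedDist (B N X Y : ℕ) : ℝ :=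
  ∑ j ∈ Finset.range N, ((embed B N j X : ℝ) - embed B N j Y) ^ 2

lemma embedDist_comm (B N X Y : ℕ) : embedDist B N X Y = embedDist B N Y X :=
  Finset.sum_congr rfl fun _ _ => by ring

lemma abs_embedDist_sub_hilbertSum_le (B : ℕ) {N X Y M : ℕ} (hN : 0 < N) (hXY : X ≤ Y)
    (hY : Y ≤ M) : |embedDist B N X Y - (B : ℝ) ^ 2 * N * hilbertSum X Y| ≤
      (M : ℝ) ^ 2 * ((B : ℝ) ^ 2 + N * (B * (2 * M))) := by
  have e : embedDist B N X Y = ∑ k ∈ Finset.Ico X Y, ∑ l ∈ Finset.Ico X Y,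
      ∑ j ∈ Finset.range N, (powApprox B N j k : ℝ) * powApprox B N j l := by
    unfold embedDist
    have (j : ℕ) : ((embed B N j X : ℝ) - embed B N j Y) ^ 2 =
        ∑ k ∈ Finset.Ico X Y, ∑ l ∈ Finset.Ico X Y,
          (powApprox B N j k : ℝ) * powApprox B N j l := by
      rw [← Finset.sum_mul_sum, ← sq, Finset.sum_Ico_eq_sub _ hXY]
      unfold embed
      push_cast
      ring
    simp_rw [this]
    rw [Finset.sum_comm]
    exact Finset.sum_congr rfl fun k _ => Finset.sum_comm
  rw [e]
  unfold hilbertSum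
  simp_rw [Finset.mul_sum]
  rw [← Finset.sum_sub_distrib]
  simp_rw [← Finset.sum_sub_distrib]
  refine (Finset.abs_sum_le_sum_abs _ _).trans ?_
  set E := (B : ℝ) ^ 2 + N * (B * (2 * M)) with hE
  have hE0 : 0 ≤ E := by positivity
  have hc : ((Y - X : ℕ) : ℝ) ≤ M := by exact_mod_cast (Nat.sub_le Y X).trans hY
  have step : ∀ k ∈ Finset.Ico X Y, |∑ l ∈ Finset.Ico X Y, (∑ j ∈ Finset.range N,
      (powApprox B N j k : ℝ) * powApprox B N j l - (B : ℝ) ^ 2 * N * (1 / ((k : ℝ) + l + 1)))|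
      ≤ M * E := by
    intro k hk
    refine (Finset.abs_sum_le_sum_abs _ _).trans ?_
    have : ∀ l ∈ Finset.Ico X Y, |∑ j ∈ Finset.range N,
      (powApprox B N j k : ℝ) * powApprox B N j l - (B : ℝ) ^ 2 * N * (1 / ((k : ℝ) + l + 1))|
      ≤ E := by
      intro l hl
      refine (abs_sum_powApprox_mul_le B hN k l).trans ?_
      have hk' : (k : ℝ) ≤ M := by exact_mod_cast (Finset.mem_Ico.1 hk).2.le.trans hY
      have hl' : (l : ℝ) ≤ M := by exact_mod_cast (Finset.mem_Ico.1 hl).2.le.trans hY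
      rw [hE]
      gcongr
      linarith
    refine (Finset.sum_le_card_nsmul _ _ _ this).trans ?_
    rw [Nat.card_Ico, nsmul_eq_mul]
    gcongr
  refine (Finset.sum_le_card_nsmul _ _ _ step).trans ?_
  rw [Nat.card_Ico, nsmul_eq_mul, sq, mul_assoc]
  gcongr

/-! ### The embedding approximates the Jensen--Shannon divergence -/

/-- The contribution of one coordinate to the Jensen--Shannon divergence. -/
noncomputable def jsTerm (x y : ℝ) : ℝ :=
  x * Real.logb 2 (2 * x / (x + y)) + y * Real.logb 2 (2 * y / (x + y))

lemma jsTerm_self (x : ℝ) : jsTerm x x = 0 := by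
  unfold jsTerm
  rcases eq_or_ne x 0 with rfl | h
  · simp
  · rw [← two_mul x, div_self (by simpa using h)]; simp

lemma jsTerm_one_zero : jsTerm 1 0 = 1 := by
  simp [jsTerm]

lemma jsTerm_comm (x y : ℝ) : jsTerm x y = jsTerm y x := by
  unfold jsTerm; rw [add_comm x y, add_comm]

lemma log_two_mul_jsTerm (x y : ℝ) : Real.log 2 * jsTerm x y =
    x * Real.log (2 * x / (x + y)) + y * Real.log (2 * y / (x + y)) := by
  have : Real.log 2 ≠ 0 := (Real.log_pos (by norm_num)).ne'
  unfold jsTerm Real.logb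
  field_simp

lemma mul_log_two_mul_div {x y : ℝ} (hx : 0 ≤ x) (hy : 0 ≤ y) :
    x * Real.log (2 * x / (x + y)) = x * Real.log (2 * x) - x * Real.log (x + y) := by
  rcases hx.eq_or_lt with rfl | hx
  · simp
  · rw [Real.log_div (by positivity) (by positivity)]; ring

lemma logKernel_mul {x y M : ℝ} (hx : 0 ≤ x) (hy : 0 ≤ y) (hM : 0 < M) :
    logKernel (M * x) (M * y) = M * (2 * (Real.log 2 * jsTerm x y)) := by
  have key {t : ℝ} : (M * t) * Real.log (M * t) = M * (t * Real.log M + t * Real.log t) := by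
    rcases eq_or_ne t 0 with rfl | h
    · simp
    · rw [Real.log_mul hM.ne' h]; ring
  rw [log_two_mul_jsTerm, mul_log_two_mul_div hx hy, add_comm x y, mul_log_two_mul_div hy hx]
  unfold logKernel
  rw [mul_left_comm 2 M x, mul_left_comm 2 M y, ← mul_add, key, key, key]
  rw [add_comm x y]
  ring

lemma sq_sub_le_log_two_mul_jsTerm {x y : ℝ} (hx : 0 ≤ x) (hy : 0 ≤ y) (hx1 : x ≤ 1)
    (hy1 : y ≤ 1) : (x - y) ^ 2 / 8 ≤ Real.log 2 * jsTerm x y := by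
  set m := √((x + y) / 2) with hm
  have hm0 : 0 ≤ m := Real.sqrt_nonneg _
  have hmsq : m ^ 2 = (x + y) / 2 := Real.sq_sqrt (by positivity)
  have key {x y : ℝ} (hx : 0 ≤ x) (hy : 0 ≤ y) (hmsq : m ^ 2 = (x + y) / 2) :
      2 * x - 2 * √x * m ≤ x * Real.log (2 * x / (x + y)) := by
    rcases hx.eq_or_lt with rfl | hx
    · simp
    have hs : 0 < √x := Real.sqrt_pos.2 hx
    have hm' : 0 < m := by
      rcases hm0.eq_or_lt with h | h
      · rw [← h] at hmsq; nlinarith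
      · exact h
    have e : 2 * x / (x + y) = (√x / m) ^ 2 := by
      rw [div_pow, Real.sq_sqrt hx.le, hmsq]; field_simp
    have l := Real.log_le_sub_one_of_pos (div_pos hm' hs)
    rw [e, Real.log_pow, Real.log_div hs.ne' hm'.ne']
    rw [Real.log_div hm'.ne' hs.ne'] at l
    have : x * (m / √x) = √x * m := by
      nth_rw 1 [← Real.mul_self_sqrt hx.le]; field_simp
    push_cast
    nlinarith
  have k1 := key hx hy hmsq
  have k2 := key hy hx (by rw [hmsq, add_comm])
  rw [log_two_mul_jsTerm]
  rw [add_comm y x] at k2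
  have hx' := Real.sq_sqrt hx
  have hy' := Real.sq_sqrt hy
  set a := √x
  set b := √y
  have ha0 : 0 ≤ a := Real.sqrt_nonneg _
  have hb0 : 0 ≤ b := Real.sqrt_nonneg _
  have h1 : (x - y) ^ 2 = (a - b) ^ 2 * (a + b) ^ 2 := by rw [← hx', ← hy']; ring
  have h2 : (a + b) ^ 2 ≤ 4 := by nlinarith [sq_nonneg (a - b)]
  have h3 : (a - b) ^ 2 / 2 ≤ (a - m) ^ 2 + (b - m) ^ 2 := by
    nlinarith [sq_nonneg (a - m + (b - m))]
  have h4 : (a - b) ^ 2 * (a + b) ^ 2 ≤ (a - b) ^ 2 * 4 := by gcongr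
  nlinarith

lemma jsTerm_nonneg {x y : ℝ} (hx : 0 ≤ x) (hy : 0 ≤ y) (hx1 : x ≤ 1)
    (hy1 : y ≤ 1) : 0 ≤ jsTerm x y := by
  have h := sq_sub_le_log_two_mul_jsTerm hx hy hx1 hy1
  have : 0 < Real.log 2 := Real.log_pos (by norm_num)
  by_contra! hc
  nlinarith [sq_nonneg (x - y)]

/-- With grid size `M`, the embedding has dimension `M ^ 2` and scale `M ^ 3`. -/
lemma abs_embedDist_sub_jsTerm_le {x y : ℝ} {M : ℕ} (hM : 0 < M) (hx : 0 ≤ x) (hy : 0 ≤ y)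
    (hx1 : x ≤ 1) (hy1 : y ≤ 1) :
    |embedDist (M ^ 3) (M ^ 2) ⌊M * x⌋₊ ⌊M * y⌋₊ - (M : ℝ) ^ 9 * (2 * Real.log 2) * jsTerm x y| ≤
      60 * (M : ℝ) ^ 8 * √M := by
  wlog hxy : x ≤ y generalizing x y
  · have := this hy hx hy1 hx1 (le_of_not_ge hxy)
    rwa [embedDist_comm, jsTerm_comm]
  have hM' : (1 : ℝ) ≤ M := by exact_mod_cast hM
  have hMx : (M : ℝ) * x ≤ M := mul_le_of_le_one_right (by positivity) hx1
  have hMy : (M : ℝ) * y ≤ M := mul_le_of_le_one_right (by positivity) hy1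
  have hXY : ⌊(M : ℝ) * x⌋₊ ≤ ⌊(M : ℝ) * y⌋₊ := Nat.floor_le_floor (by gcongr)
  have hY : ⌊(M : ℝ) * y⌋₊ ≤ M := by
    have := Nat.floor_le_floor hMy
    rwa [Nat.floor_natCast] at this
  have h1 := abs_embedDist_sub_hilbertSum_le (M ^ 3) (N := M ^ 2) (by positivity) hXY hY
  have h2 := abs_hilbertSum_sub_logKernel_le hXY
  have h3 := abs_logKernel_sub_floor_le (a := M * x) (b := M * y) (by positivity) (by positivity)
    hMx hMy hM'
  rw [logKernel_mul hx hy (by positivity)] at h3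
  have hq : 1 ≤ √(M : ℝ) := Real.one_le_sqrt.2 hM'
  push_cast at h1
  set e := embedDist (M ^ 3) (M ^ 2) ⌊M * x⌋₊ ⌊M * y⌋₊
  set D := hilbertSum ⌊(M : ℝ) * x⌋₊ ⌊(M : ℝ) * y⌋₊
  set L := logKernel (⌊(M : ℝ) * x⌋₊ : ℝ) ⌊(M : ℝ) * y⌋₊
  set q := √(M : ℝ)
  have h4 : |D - M * (2 * (Real.log 2 * jsTerm x y))| ≤ 57 * q := by
    rw [abs_le] at *
    constructor <;> linarith
  have h5 : |(M : ℝ) ^ 8 * D - M ^ 9 * (2 * Real.log 2) * jsTerm x y| ≤ M ^ 8 * (57 * q) := by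
    rw [show (M : ℝ) ^ 8 * D - M ^ 9 * (2 * Real.log 2) * jsTerm x y =
      M ^ 8 * (D - M * (2 * (Real.log 2 * jsTerm x y))) by ring, abs_mul,
      abs_of_nonneg (by positivity : (0 : ℝ) ≤ (M : ℝ) ^ 8)]
    gcongr
  have h6 : (M : ℝ) ^ 8 ≤ M ^ 8 * q := le_mul_of_one_le_right (by positivity) hq
  have e1 : ((M : ℝ) ^ 3) ^ 2 * M ^ 2 * D = M ^ 8 * D := by ring
  have e2 : (M : ℝ) ^ 2 * (((M : ℝ) ^ 3) ^ 2 + M ^ 2 * (M ^ 3 * (2 * M))) = 3 * M ^ 8 := by ring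
  rw [e1, e2] at h1
  rw [abs_le] at *
  constructor <;> linarith

lemma inv_sq_le_abs_sub {x y : ℚ} {m : ℕ} (hx : x.den ≤ m) (hy : y.den ≤ m) (hxy : x ≠ y) :
    1 / (m : ℝ) ^ 2 ≤ |(x : ℝ) - y| := by
  have hx0 : (0 : ℝ) < x.den := by exact_mod_cast x.den_pos
  have hy0 : (0 : ℝ) < y.den := by exact_mod_cast y.den_pos
  have ex : (x : ℝ) = x.num / x.den := Rat.cast_def x
  have ey : (y : ℝ) = y.num / y.den := Rat.cast_def y
  have hne : x.num * y.den - y.num * x.den ≠ 0 := by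
    intro h
    exact hxy (Rat.eq_iff_mul_eq_mul.2 (sub_eq_zero.1 h))
  have h1 : (1 : ℝ) ≤ |(x.num : ℝ) * y.den - y.num * x.den| := by
    exact_mod_cast Int.one_le_abs hne
  have e : (x : ℝ) - y = ((x.num : ℝ) * y.den - y.num * x.den) / (x.den * y.den) := by
    rw [ex, ey]; field_simp
  rw [e, abs_div, abs_of_pos (mul_pos hx0 hy0), sq]
  have hx' : (x.den : ℝ) ≤ m := by exact_mod_cast hx
  have hy' : (y.den : ℝ) ≤ m := by exact_mod_cast hy
  gcongr

/-- The grid size that makes the embedding accurate up to the factor `1 ± 1 / (10 * k)` on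
rational numbers with denominators at most `d ^ c`. -/
def gridSize (c d k : ℕ) : ℕ := (2400 * k * d ^ (4 * c)) ^ 2

lemma gridSize_pos {c d k : ℕ} (hd : 0 < d) (hk : 0 < k) : 0 < gridSize c d k := by
  unfold gridSize; positivity

/-- The position of `x` in the grid of size `M`. -/
def gridIndex (M : ℕ) (x : ℚ) : ℕ := x.num.natAbs * M / x.den

lemma gridIndex_eq_floor (M : ℕ) {x : ℚ} (hx : 0 ≤ x) : gridIndex M x = ⌊(M : ℝ) * x⌋₊ := by
  have e : (x : ℝ) = x.num.natAbs / x.den := by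
    rw [Nat.cast_natAbs, abs_of_nonneg (Rat.num_nonneg.2 hx)]
    exact Rat.cast_def x
  rw [e, ← mul_div_assoc, mul_comm, ← Nat.cast_mul, Nat.floor_div_eq_div]
  rfl

lemma gridIndex_le (M : ℕ) {x : ℚ} (hx : 0 ≤ x) (hx1 : x ≤ 1) : gridIndex M x ≤ M := by
  have hx1' : (x : ℝ) ≤ 1 := by exact_mod_cast hx1
  rw [gridIndex_eq_floor M hx]
  have := Nat.floor_le_floor (mul_le_of_le_one_right (Nat.cast_nonneg M) hx1')
  rwa [Nat.floor_natCast] at this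

/-- The factor by which the embedding stretches the Jensen--Shannon divergence. -/
noncomputable def embedScale (M : ℕ) : ℝ := (M : ℝ) ^ 9 * (2 * Real.log 2)

lemma embedScale_pos {M : ℕ} (hM : 0 < M) : 0 < embedScale M := by
  have : 0 < Real.log 2 := Real.log_pos (by norm_num)
  unfold embedScale
  positivity

lemma abs_embedDist_sub_jsTerm_le_mul {c d k M : ℕ} (hd : 0 < d) (hk : 0 < k)
    (hM : M = gridSize c d k) {x y : ℚ}
    (hx : 0 ≤ x) (hy : 0 ≤ y) (hx1 : x ≤ 1) (hy1 : y ≤ 1) (hxd : x.den ≤ d ^ c)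
    (hyd : y.den ≤ d ^ c) :
    |embedDist (M ^ 3) (M ^ 2) (gridIndex M x) (gridIndex M y) - embedScale M * jsTerm x y| ≤
      1 / (10 * k) * (embedScale M * jsTerm x y) := by
  rcases eq_or_ne x y with rfl | hxy
  · simp [jsTerm_self, embedDist]
  have hM0 : 0 < M := hM ▸ gridSize_pos hd hk
  have hx' : (0 : ℝ) ≤ x := by exact_mod_cast hx
  have hy' : (0 : ℝ) ≤ y := by exact_mod_cast hy
  have hx1' : (x : ℝ) ≤ 1 := by exact_mod_cast hx1
  have hy1' : (y : ℝ) ≤ 1 := by exact_mod_cast hy1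
  rw [gridIndex_eq_floor M hx, gridIndex_eq_floor M hy]
  refine (abs_embedDist_sub_jsTerm_le hM0 hx' hy' hx1' hy1').trans ?_
  set q : ℝ := 2400 * k * (d : ℝ) ^ (4 * c) with hq
  have hq0 : 0 < q := by positivity
  have hMq : (M : ℝ) = q ^ 2 := by rw [hM, hq]; unfold gridSize; push_cast; rfl
  have hsq : √(M : ℝ) = q := by rw [hMq, Real.sqrt_sq hq0.le]
  have h1 := sq_sub_le_log_two_mul_jsTerm hx' hy' hx1' hy1'
  have h2 : 1 / (d : ℝ) ^ (4 * c) ≤ ((x : ℝ) - y) ^ 2 := by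
    have := inv_sq_le_abs_sub hxd hyd hxy
    rw [← sq_abs]
    calc 1 / (d : ℝ) ^ (4 * c) = (1 / ((d ^ c : ℕ) : ℝ) ^ 2) ^ 2 := by
          push_cast; rw [div_pow, one_pow, ← pow_mul, ← pow_mul]; congr 2; ring
      _ ≤ _ := by gcongr
  have h3 : 1 / (d : ℝ) ^ (4 * c) / 8 ≤ Real.log 2 * jsTerm x y := by linarith
  have hd' : (0 : ℝ) < (d : ℝ) ^ (4 * c) := by positivity
  have hk' : (0 : ℝ) < k := by positivity
  rw [hsq]
  calc 60 * (M : ℝ) ^ 8 * q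
      = 1 / (10 * k) * ((M : ℝ) ^ 9 * 2 * (1 / (d : ℝ) ^ (4 * c) / 8)) := by
        rw [hMq, hq]; field_simp; ring
    _ ≤ 1 / (10 * k) * ((M : ℝ) ^ 9 * 2 * (Real.log 2 * jsTerm x y)) := by gcongr
    _ = _ := by unfold embedScale; ring

/-! ### A four-wise independent family of signs -/

/-- The cubic polynomial with coefficients `s`, modulo `2 ^ (n + 1)`. -/
def hashVal {n : ℕ} (s : Fin 4 → ZMod (2 ^ (n + 1))) (x : ℕ) : ZMod (2 ^ (n + 1)) :=
  s 0 + s 1 * x + s 2 * x ^ 2 + s 3 * x ^ 3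

/-- The leading bit of a residue modulo `2 ^ (n + 1)`. -/
def topBit {n : ℕ} (z : ZMod (2 ^ (n + 1))) : ℕ := z.val / 2 ^ n

/-- The random sign attached to `x` by the seed `s`. -/
def hashSign {n : ℕ} (s : Fin 4 → ZMod (2 ^ (n + 1))) (x : ℕ) : ℝ := (-1) ^ topBit (hashVal s x)

lemma topBit_lt_two {n : ℕ} (z : ZMod (2 ^ (n + 1))) : topBit z < 2 := by
  unfold topBit
  rw [Nat.div_lt_iff_lt_mul (by positivity), ← pow_succ']
  exact z.val_lt

lemma topBit_add_half {n : ℕ} (z : ZMod (2 ^ (n + 1))) :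
    (-1 : ℝ) ^ topBit (z + (2 : ZMod (2 ^ (n + 1))) ^ n) = -(-1) ^ topBit z := by
  have hv : ((2 : ZMod (2 ^ (n + 1))) ^ n).val = 2 ^ n := by
    have := ZMod.val_natCast_of_lt (n := 2 ^ (n + 1)) (a := 2 ^ n)
      (Nat.pow_lt_pow_right (by norm_num) (Nat.lt_succ_self n))
    push_cast at this
    exact this
  have h2 := topBit_lt_two z
  unfold topBit at *
  rw [ZMod.val_add, hv]
  have hz : z.val < 2 ^ n * 2 := z.val_lt.trans_eq (pow_succ 2 n)
  have hp : 0 < 2 ^ n := by positivity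
  generalize z.val = v at *
  rw [pow_succ]
  generalize 2 ^ n = p at *
  rcases lt_or_ge v p with h | h
  · rw [Nat.mod_eq_of_lt (by omega), Nat.add_div_right _ hp, Nat.div_eq_of_lt h]
    simp
  · rw [Nat.mod_eq_sub_mod (by omega), Nat.mod_eq_of_lt (by omega), Nat.div_eq_of_lt (by omega),
      show v / p = 1 from (Nat.div_eq_iff hp).2 ⟨by omega, by omega⟩]
    simp

lemma hashSign_mul_self {n : ℕ} (s : Fin 4 → ZMod (2 ^ (n + 1))) (x : ℕ) :
    hashSign s x * hashSign s x = 1 := by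
  unfold hashSign
  rw [← pow_add, Even.neg_one_pow ⟨_, rfl⟩]

lemma exists_mul_eq_half {n : ℕ} {q : ℤ} (hq : q ≠ 0) (hq' : |q| < 2 ^ (n + 1)) :
    ∃ r : ZMod (2 ^ (n + 1)), r * (q : ZMod (2 ^ (n + 1))) = 2 ^ n := by
  obtain ⟨e, u, hu, h⟩ := Nat.exists_eq_two_pow_mul_odd (Int.natAbs_ne_zero.2 hq)
  have he : e ≤ n := by
    have h1 : 2 ^ e ≤ q.natAbs := by rw [h]; exact Nat.le_mul_of_pos_right _ hu.pos
    have h2 : q.natAbs < 2 ^ (n + 1) := by zify; simpa using hq'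
    have := (Nat.pow_lt_pow_iff_right (by norm_num)).1 (h1.trans_lt h2)
    omega
  have zero : (2 : ZMod (2 ^ (n + 1))) ^ n * 2 = 0 := by
    have := ZMod.natCast_self (2 ^ (n + 1))
    push_cast at this
    rw [← pow_succ]
    exact this
  have abs : (2 : ZMod (2 ^ (n + 1))) ^ (n - e) * (q.natAbs : ZMod (2 ^ (n + 1))) = 2 ^ n := by
    obtain ⟨t, rfl⟩ := hu
    rw [h]
    push_cast
    rw [← mul_assoc, ← pow_add, Nat.sub_add_cancel he, mul_add, ← mul_assoc, zero]
    ring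
  rcases Int.natAbs_eq q with h' | h'
  · exact ⟨2 ^ (n - e), by rw [h', Int.cast_natCast]; exact abs⟩
  · refine ⟨-2 ^ (n - e), ?_⟩
    rw [h', Int.cast_neg, Int.cast_natCast, neg_mul_neg]
    exact abs

lemma sum_hashSign_mul_eq_zero {n R x y z w : ℕ} (hR : R ^ 3 ≤ 2 ^ (n + 1)) (hx : x < R) (hy : y < R)
    (hz : z < R) (hw : w < R) (hxy : x ≠ y) (hxz : x ≠ z) (hxw : x ≠ w) :
    ∑ s : Fin 4 → ZMod (2 ^ (n + 1)),
      hashSign s x * (hashSign s y * hashSign s z * hashSign s w) = 0 := by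
  have lt {y : ℕ} (hy : y < R) : |(x : ℤ) - y| < R := by rw [abs_lt]; constructor <;> omega
  obtain ⟨r, hr⟩ := exists_mul_eq_half (n := n) (q := ((x : ℤ) - y) * (x - z) * (x - w))
    (mul_ne_zero (mul_ne_zero (by omega) (by omega)) (by omega)) (by
      rw [abs_mul, abs_mul]
      have hR' : (0 : ℤ) < R := by omega
      calc |(x : ℤ) - y| * |(x : ℤ) - z| * |(x : ℤ) - w| < R * R * R := by
            have := lt hy; have := lt hz; have := lt hw
            gcongr
        _ = ((R ^ 3 : ℕ) : ℤ) := by push_cast; ring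
        _ ≤ _ := by exact_mod_cast hR)
  push_cast at hr
  let δ : Fin 4 → ZMod (2 ^ (n + 1)) :=
    ![-(r * (y * z * w)), r * (y * z + y * w + z * w), -(r * (y + z + w)), r]
  have shift (s : Fin 4 → ZMod (2 ^ (n + 1))) (t : ℕ) :
      hashVal (s + δ) t = hashVal s t + r * (((t : ZMod (2 ^ (n + 1))) - y) * (t - z) * (t - w)) := by
    simp only [hashVal, Pi.add_apply, δ, Matrix.cons_val_zero, Matrix.cons_val_one,
      Matrix.cons_val]
    ring
  have hsx (s : Fin 4 → ZMod (2 ^ (n + 1))) : hashSign (s + δ) x = -hashSign s x := by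
    unfold hashSign
    rw [shift, hr, topBit_add_half]
  have hsy (s : Fin 4 → ZMod (2 ^ (n + 1))) : hashSign (s + δ) y = hashSign s y := by
    unfold hashSign
    rw [shift]; simp
  have hsz (s : Fin 4 → ZMod (2 ^ (n + 1))) : hashSign (s + δ) z = hashSign s z := by
    unfold hashSign
    rw [shift]; simp
  have hsw (s : Fin 4 → ZMod (2 ^ (n + 1))) : hashSign (s + δ) w = hashSign s w := by
    unfold hashSign
    rw [shift]; simp
  have := Fintype.sum_equiv (Equiv.addRight δ)
    (fun s => hashSign (s + δ) x * (hashSign (s + δ) y * hashSign (s + δ) z * hashSign (s + δ) w))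
    (fun s => hashSign s x * (hashSign s y * hashSign s z * hashSign s w)) (fun s => rfl)
  simp only [hsx, hsy, hsz, hsw, neg_mul, Finset.sum_neg_distrib] at this
  linarith

/-! ### The second moment method -/

section Sketch

variable {Ω ι : Type*} [Fintype Ω] [Fintype ι] [DecidableEq ι] {K : ℕ}

lemma sum_sq_sketch_sub_le (g : Ω → Fin K → ι → ℝ) (v : ι → ℝ)
    (hg : ∀ s r a, g s r a * g s r a = 1)
    (hg' : ∀ x y z w : Fin K × ι, x ≠ y → x ≠ z → x ≠ w →
      ∑ s, g s x.1 x.2 * (g s y.1 y.2 * g s z.1 z.2 * g s w.1 w.2) = 0) :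
    ∑ s, (∑ r, (∑ a, v a * g s r a) ^ 2 - K * ∑ a, v a ^ 2) ^ 2 ≤
      Fintype.card Ω * (2 * K * (∑ a, v a ^ 2) ^ 2) := by
  let τ (s : Ω) (u : Fin K × ι × ι) : ℝ :=
    g s u.1 u.2.1 * g s u.1 u.2.2 - if u.2.1 = u.2.2 then 1 else 0
  let c (u : Fin K × ι × ι) : ℝ := v u.2.1 * v u.2.2
  let sw (u : Fin K × ι × ι) : Fin K × ι × ι := (u.1, u.2.2, u.2.1)
  have expand (s : Ω) : ∑ r, (∑ a, v a * g s r a) ^ 2 - K * ∑ a, v a ^ 2 = ∑ u, c u * τ s u := by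
    rw [Fintype.sum_prod_type]
    have h1 : (K : ℝ) * ∑ a, v a ^ 2 = ∑ _r : Fin K, ∑ a, v a ^ 2 := by simp
    rw [h1, ← Finset.sum_sub_distrib]
    refine Finset.sum_congr rfl fun r _ => ?_
    rw [Fintype.sum_prod_type, sq, Finset.sum_mul_sum, ← Finset.sum_sub_distrib]
    refine Finset.sum_congr rfl fun a _ => ?_
    simp only [c, τ, mul_sub, Finset.sum_sub_distrib, mul_ite, mul_one, mul_zero,
      Finset.sum_ite_eq, Finset.mem_univ, if_true, ← sq]
    congr 1
    exact Finset.sum_congr rfl fun b _ => by ring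
  have habs (s : Ω) (r : Fin K) (a : ι) : |g s r a| = 1 := by
    have := hg s r a
    rw [← abs_mul_abs_self] at this
    nlinarith [abs_nonneg (g s r a)]
  have hτ (s : Ω) (u : Fin K × ι × ι) : |τ s u| ≤ 1 := by
    simp only [τ]
    split_ifs with h
    · rw [h, hg]; simp
    · rw [sub_zero, abs_mul, habs, habs]; simp
  have corr (u u' : Fin K × ι × ι) : |∑ s, τ s u * τ s u'| ≤
      Fintype.card Ω * ((if u' = u then 1 else 0) + if u' = sw u then 1 else 0) := by
    by_cases h : u' = u ∨ u' = sw u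
    · have h1 : (1 : ℝ) ≤ (if u' = u then 1 else 0) + if u' = sw u then 1 else 0 := by
        rcases h with h | h
        · rw [if_pos h]; split_ifs <;> norm_num
        · rw [if_pos h]; split_ifs <;> norm_num
      calc |∑ s, τ s u * τ s u'| ≤ ∑ s, |τ s u * τ s u'| := Finset.abs_sum_le_sum_abs _ _
        _ ≤ ∑ _s : Ω, (1 : ℝ) := Finset.sum_le_sum fun s _ => by
            rw [abs_mul]; exact mul_le_one₀ (hτ s u) (abs_nonneg _) (hτ s u')
        _ = Fintype.card Ω * 1 := by simp
        _ ≤ _ := by gcongr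
    · have hz : ∑ s, τ s u * τ s u' = 0 := by
        obtain ⟨r, a, b⟩ := u
        obtain ⟨r', a', b'⟩ := u'
        simp only [τ]
        by_cases hab : a = b
        · subst hab; simp [hg]
        by_cases hab' : a' = b'
        · subst hab'; simp [hg]
        simp only [if_neg hab, if_neg hab', sub_zero]
        have key : ((r, a) ≠ (r', a') ∧ (r, a) ≠ (r', b')) ∨
            ((r, b) ≠ (r', a') ∧ (r, b) ≠ (r', b')) := by
          simp only [sw, Prod.mk.injEq, not_or, not_and, ne_eq] at h ⊢
          grind
        rcases key with ⟨h1, h2⟩ | ⟨h1, h2⟩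
        · rw [← hg' (r, a) (r, b) (r', a') (r', b') (by simpa using hab) h1 h2]
          exact Finset.sum_congr rfl fun s _ => by ring
        · rw [← hg' (r, b) (r, a) (r', a') (r', b') (by simpa using Ne.symm hab) h1 h2]
          exact Finset.sum_congr rfl fun s _ => by ring
      rw [hz, abs_zero]
      positivity
  have hc (u : Fin K × ι × ι) : c (sw u) = c u := mul_comm _ _
  calc ∑ s, (∑ r, (∑ a, v a * g s r a) ^ 2 - K * ∑ a, v a ^ 2) ^ 2
      = ∑ u, ∑ u', c u * c u' * ∑ s, τ s u * τ s u' := by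
        simp_rw [expand, sq, Finset.sum_mul_sum, Finset.mul_sum]
        rw [Finset.sum_comm]
        refine Finset.sum_congr rfl fun u _ => ?_
        rw [Finset.sum_comm]
        exact Finset.sum_congr rfl fun u' _ => Finset.sum_congr rfl fun s _ => by ring
    _ ≤ ∑ u, ∑ u', |c u| * |c u'| *
          (Fintype.card Ω * ((if u' = u then 1 else 0) + if u' = sw u then 1 else 0)) := by
        refine Finset.sum_le_sum fun u _ => Finset.sum_le_sum fun u' _ => ?_
        refine (le_abs_self _).trans ?_
        rw [abs_mul, abs_mul]
        exact mul_le_mul_of_nonneg_left (corr u u') (by positivity)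
    _ = ∑ u, Fintype.card Ω * (2 * c u ^ 2) := by
        refine Finset.sum_congr rfl fun u _ => ?_
        simp only [mul_add, mul_ite, mul_one, mul_zero, Finset.sum_add_distrib,
          Finset.sum_ite_eq', Finset.mem_univ, if_true, hc]
        rw [← sq_abs (c u)]
        ring
    _ = _ := by
        rw [← Finset.mul_sum, ← Finset.mul_sum, Fintype.sum_prod_type]
        simp only [Fintype.sum_prod_type, c, mul_pow, ← Finset.mul_sum, ← Finset.sum_mul,
          Finset.sum_const, Finset.card_univ, Fintype.card_fin, nsmul_eq_mul]
        ring

/-- Chebyshev's inequality for the sketch: the estimate of the squared norm is wrong by more than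
the factor `1 ± η` for a fraction of at most `2 / (η ^ 2 * K)` of the seeds. -/
lemma card_bad_seeds_le (g : Ω → Fin K → ι → ℝ) (v : ι → ℝ) {η : ℝ} (hη : 0 < η) (hK : 0 < K)
    (hg : ∀ s r a, g s r a * g s r a = 1)
    (hg' : ∀ x y z w : Fin K × ι, x ≠ y → x ≠ z → x ≠ w →
      ∑ s, g s x.1 x.2 * (g s y.1 y.2 * g s z.1 z.2 * g s w.1 w.2) = 0)
    (bad : Finset Ω) (hbad : ∀ s ∈ bad, η * (K * ∑ a, v a ^ 2) <
      |∑ r, (∑ a, v a * g s r a) ^ 2 - K * ∑ a, v a ^ 2|) :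
    (bad.card : ℝ) ≤ Fintype.card Ω * (2 / (η ^ 2 * K)) := by
  have h := sum_sq_sketch_sub_le g v hg hg'
  have hK' : (0 : ℝ) < K := by exact_mod_cast hK
  set N := ∑ a, v a ^ 2 with hN
  have hN0 : 0 ≤ N := Finset.sum_nonneg fun a _ => sq_nonneg _
  rcases hN0.eq_or_lt with h0 | h0
  · have hv : ∀ a, v a = 0 := fun a => by
      have := (Finset.sum_eq_zero_iff_of_nonneg (fun a _ => sq_nonneg (v a))).1 h0.symm a
        (Finset.mem_univ a)
      exact pow_eq_zero_iff (two_ne_zero) |>.1 this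
    have : bad = ∅ := Finset.eq_empty_of_forall_notMem fun s hs => by
      have := hbad s hs
      simp [hv, ← h0] at this
    rw [this]
    simp only [Finset.card_empty, Nat.cast_zero]
    positivity
  · have h1 : (bad.card : ℝ) * (η * (K * N)) ^ 2 ≤
        ∑ s, (∑ r, (∑ a, v a * g s r a) ^ 2 - K * N) ^ 2 := by
      rw [← nsmul_eq_mul]
      refine (Finset.card_nsmul_le_sum bad _ _ fun s hs => ?_).trans
        (Finset.sum_le_sum_of_subset_of_nonneg (Finset.subset_univ bad) fun s _ _ => sq_nonneg _)
      rw [← sq_abs (_ - _)]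
      exact pow_le_pow_left₀ (by positivity) (hbad s hs).le 2
    have h2 : (bad.card : ℝ) * (η * (K * N)) ^ 2 ≤
        (Fintype.card Ω * (2 / (η ^ 2 * K))) * (η * (K * N)) ^ 2 := by
      refine (h1.trans h).trans_eq ?_
      field_simp
    exact le_of_mul_le_mul_right h2 (by positivity)

end Sketch

/-! ### Random seeds from coin tosses -/

/-- The number whose binary digits are the results of the coin tosses `j, j + 4, j + 8, …`. -/
def seedVal (ω : ℕ → Bool) (j : ℕ) : ℕ → ℕ
  | 0 => 0
  | n + 1 => 2 * seedVal ω j n + (ω (4 * n + j)).toNat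

lemma seedVal_lt (ω : ℕ → Bool) (j n : ℕ) : seedVal ω j n < 2 ^ n := by
  induction n with
  | zero => simp [seedVal]
  | succ n ih =>
    have := Bool.toNat_le (ω (4 * n + j))
    simp only [seedVal, pow_succ]
    omega

lemma coin_eq_of_seedVal_eq {ω ω' : ℕ → Bool} {j n : ℕ} (h : seedVal ω j n = seedVal ω' j n) :
    ∀ i < n, ω (4 * i + j) = ω' (4 * i + j) := by
  induction n with
  | zero => simp
  | succ n ih =>
    simp only [seedVal] at h
    have h1 := Bool.toNat_le (ω (4 * n + j))
    have h2 := Bool.toNat_le (ω' (4 * n + j))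
    intro i hi
    rcases Nat.lt_succ_iff_lt_or_eq.1 hi with hi | rfl
    · exact ih (by omega) i hi
    · have : (ω (4 * i + j)).toNat = (ω' (4 * i + j)).toNat := by omega
      revert this
      cases ω (4 * i + j) <;> cases ω' (4 * i + j) <;> simp

lemma coinMeasure_agree (ω₀ : ℕ → Bool) (L : ℕ) :
    coinMeasure {ω | ∀ i < L, ω i = ω₀ i} = (2⁻¹ : ENNReal) ^ L := by
  have e : {ω : ℕ → Bool | ∀ i < L, ω i = ω₀ i} =
      Set.pi (Finset.range L : Set ℕ) fun i => {ω₀ i} := by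
    ext ω; simp [Set.mem_pi]
  rw [e, coinMeasure, Measure.infinitePi_pi _ (fun i _ => MeasurableSet.singleton _)]
  simp

/-- The four seeds, of `m` bits each, read off the first `4 * m` coin tosses. -/
def seeds (m : ℕ) (ω : ℕ → Bool) : Fin 4 → ZMod (2 ^ m) := fun j => (seedVal ω j m : ZMod (2 ^ m))

lemma coinMeasure_seeds_eq_le (m : ℕ) (s : Fin 4 → ZMod (2 ^ m)) :
    coinMeasure {ω | seeds m ω = s} ≤ (2⁻¹ : ENNReal) ^ (4 * m) := by
  rcases Set.eq_empty_or_nonempty {ω | seeds m ω = s} with h | ⟨ω₀, h⟩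
  · simp [h]
  rw [← coinMeasure_agree ω₀]
  refine measure_mono fun ω hω i hi => ?_
  have hs : seeds m ω = seeds m ω₀ := Eq.trans hω (Eq.symm h)
  have hj := congr_fun hs ⟨i % 4, Nat.mod_lt _ (by norm_num)⟩
  simp only [seeds] at hj
  have hv : seedVal ω (i % 4) m = seedVal ω₀ (i % 4) m := by
    have := (ZMod.natCast_eq_natCast_iff' _ _ _).1 hj
    rwa [Nat.mod_eq_of_lt (seedVal_lt _ _ _), Nat.mod_eq_of_lt (seedVal_lt _ _ _)] at this
  have := coin_eq_of_seedVal_eq hv (i / 4) (by omega)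
  rwa [Nat.div_add_mod] at this

lemma coinMeasure_seeds_mem_le (m : ℕ) (bad : Finset (Fin 4 → ZMod (2 ^ m))) {δ : ℝ}
    (h : (bad.card : ℝ) ≤ Fintype.card (Fin 4 → ZMod (2 ^ m)) * δ) :
    coinMeasure {ω | seeds m ω ∈ bad} ≤ ENNReal.ofReal δ := by
  have e : {ω | seeds m ω ∈ bad} = ⋃ s ∈ bad, {ω | seeds m ω = s} := by
    ext ω; simp
  rw [e]
  have hc : (Fintype.card (Fin 4 → ZMod (2 ^ m)) : ℝ) = 2 ^ (4 * m) := by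
    rw [Fintype.card_fun, ZMod.card, Fintype.card_fin, ← pow_mul]; push_cast; rw [mul_comm]
  calc _ ≤ ∑ s ∈ bad, coinMeasure {ω | seeds m ω = s} := measure_biUnion_finset_le _ _
    _ ≤ ∑ _s ∈ bad, (2⁻¹ : ENNReal) ^ (4 * m) :=
        Finset.sum_le_sum fun s _ => coinMeasure_seeds_eq_le m s
    _ = ENNReal.ofReal (bad.card * (2⁻¹) ^ (4 * m)) := by
        rw [Finset.sum_const, nsmul_eq_mul, ENNReal.ofReal_mul (by positivity),
          ENNReal.ofReal_natCast, ENNReal.ofReal_pow (by positivity),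
          ENNReal.ofReal_inv_of_pos (by norm_num)]
        simp
    _ ≤ ENNReal.ofReal δ := by
        refine ENNReal.ofReal_le_ofReal ?_
        rw [hc] at h
        rw [inv_pow, ← div_eq_mul_inv, div_le_iff₀ (by positivity)]
        linarith

/-! ### Reasoning about programs within a memory bound -/

/-- All cells hold at most `V`, and only the cells with addresses below `A` are in use. -/
structure Bounded (A V : ℕ) (m : Mem) : Prop where
  le : ∀ a, m a ≤ V
  zero : ∀ a, A ≤ a → m a = 0

lemma Bounded.update {A V : ℕ} {m : Mem} (h : Bounded A V m) {a v : ℕ} (ha : a < A) (hv : v ≤ V) :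
    Bounded A V (m.update a v) where
  le b := by
    rw [Finsupp.coe_update, Function.update_apply]
    split_ifs
    exacts [hv, h.le b]
  zero b hb := by
    rw [Finsupp.coe_update, Function.update_of_ne (by omega)]
    exact h.zero b hb

lemma Bounded.space_le {A V : ℕ} {m : Mem} (h : Bounded A V m) :
    m.space ≤ A * (A.size + V.size) := by
  unfold Mem.space Finsupp.sum
  have hsub : m.support ⊆ Finset.range A := fun a ha => by
    by_contra hc
    exact (Finsupp.mem_support_iff.1 ha) (h.zero a (by simpa using hc))
  refine (Finset.sum_le_sum_of_subset hsub).trans ?_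
  refine (Finset.sum_le_card_nsmul _ _ (A.size + V.size) fun a ha => ?_).trans (by simp)
  exact Nat.add_le_add (Nat.size_le_size (Finset.mem_range.1 ha).le) (Nat.size_le_size (h.le a))

/-- `S` bits suffice for every memory that is bounded by `A` and `V`. -/
def Suffices (A V : ℕ) (S : ℝ) : Prop := ∀ m : Mem, Bounded A V m → (m.space : ℝ) ≤ S

/-- The program `P` runs from `c` to `c'` in any space that suffices for bounded memories. -/
def Runs (A V : ℕ) (P : Prog) (c c' : Config) : Prop := ∀ S, Suffices A V S → Run S P c c'

/-- The program `P` tosses no coins when started with the memory `m`, keeps the memory bounded,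
and ends with a memory that satisfies `Q`. -/
def Ensures (A V : ℕ) (P : Prog) (m : Mem) (Q : Mem → Prop) : Prop :=
  ∃ m', (∀ ω, Runs A V P ⟨m, ω⟩ ⟨m', ω⟩) ∧ Q m'

variable {A V : ℕ}

lemma Runs.seq {P Q : Prog} {c c' c'' : Config} (h : Runs A V P c c') (h' : Runs A V Q c' c'') :
    Runs A V (.seq P Q) c c'' := fun _ hS => .seq (h _ hS) (h' _ hS)

lemma Runs.assign {a e : Exp} {m : Mem} {ω : ℕ → Bool} (hm : Bounded A V m)
    (ha : a.eval m < A) (he : e.eval m ≤ V) :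
    Runs A V (.assign a e) ⟨m, ω⟩ ⟨m.update (a.eval m) (e.eval m), ω⟩ :=
  fun _ hS => .assign (hS m hm) rfl (hS _ (hm.update ha he))

lemma Runs.flip {a : Exp} {m : Mem} {ω : ℕ → Bool} (hm : Bounded A V m)
    (ha : a.eval m < A) (hV : 1 ≤ V) :
    Runs A V (.flip a) ⟨m, ω⟩ ⟨m.update (a.eval m) (ω 0).toNat, fun n => ω (n + 1)⟩ :=
  fun _ hS => .flip (hS m hm) rfl (hS _ (hm.update ha ((Bool.toNat_le _).trans hV)))

lemma Ensures.assign {a e : Exp} {m : Mem} {Q : Mem → Prop} (hm : Bounded A V m)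
    (ha : a.eval m < A) (he : e.eval m ≤ V) (hQ : Q (m.update (a.eval m) (e.eval m))) :
    Ensures A V (.assign a e) m Q :=
  ⟨_, fun _ => .assign hm ha he, hQ⟩

lemma Ensures.seq {P P' : Prog} {m : Mem} {Q Q' : Mem → Prop} (h : Ensures A V P m Q')
    (h' : ∀ m', Q' m' → Ensures A V P' m' Q) : Ensures A V (.seq P P') m Q := by
  obtain ⟨m', hr, hq⟩ := h
  obtain ⟨m'', hr', hq'⟩ := h' m' hq
  exact ⟨m'', fun ω => (hr ω).seq (hr' ω), hq'⟩

lemma Ensures.assign_seq {a e : Exp} {P : Prog} {m : Mem} {Q : Mem → Prop} (hm : Bounded A V m)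
    (ha : a.eval m < A) (he : e.eval m ≤ V)
    (h : Bounded A V (m.update (a.eval m) (e.eval m)) →
      Ensures A V P (m.update (a.eval m) (e.eval m)) Q) :
    Ensures A V (.seq (.assign a e) P) m Q :=
  Ensures.seq (Q' := fun m' => m' = m.update (a.eval m) (e.eval m)) (.assign hm ha he rfl)
    fun _ hm' => hm' ▸ h (hm.update ha he)

lemma Ensures.mono {P : Prog} {m : Mem} {Q Q' : Mem → Prop} (h : Ensures A V P m Q)
    (hQ : ∀ m', Q m' → Q' m') : Ensures A V P m Q' :=
  let ⟨m', hr, hq⟩ := h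
  ⟨m', hr, hQ m' hq⟩

/-- The contents of the cell with address `a`. -/
def cell (a : ℕ) : Exp := .read (.lit a)

@[simp] lemma eval_cell (a : ℕ) (m : Mem) : (cell a).eval m = m a := rfl

@[simp] lemma eval_lit (a : ℕ) (m : Mem) : (Exp.lit a).eval m = a := rfl

/-- Counts the cell `a` down to `0`, running `P` each time. -/
def Prog.countdown (a : ℕ) (P : Prog) : Prog :=
  .loop (cell a) (.seq (.assign (.lit a) (.sub (cell a) (.lit 1))) P)

lemma Ensures.countdown {a : ℕ} {P : Prog} (Inv : ℕ → Mem → Prop) {m : Mem} (ha : a < A)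
    (hm : Bounded A V m) (h : Inv (m a) m)
    (step : ∀ i m', i < m a → Bounded A V m' → m' a = i + 1 → Inv (i + 1) m' →
      Ensures A V P (m'.update a i) fun m'' => Bounded A V m'' ∧ m'' a = i ∧ Inv i m'') :
    Ensures A V (.countdown a P) m fun m' => Bounded A V m' ∧ m' a = 0 ∧ Inv 0 m' := by
  have main : ∀ i m', i ≤ m a → Bounded A V m' → m' a = i → Inv i m' →
      Ensures A V (.countdown a P) m' fun m'' => Bounded A V m'' ∧ m'' a = 0 ∧ Inv 0 m'' := by
    intro i
    induction i with
    | zero =>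
      intro m' _ hm' ha' hI
      exact ⟨m', fun ω S hS => .loop_false (by simpa using ha') (hS m' hm'), hm', ha', hI⟩
    | succ i ih =>
      intro m' hi hm' ha' hI
      obtain ⟨m₁, hr, hb, hc, hI'⟩ := step i m' (by omega) hm' ha' hI
      obtain ⟨m₂, hr', hq⟩ := ih m₁ (by omega) hb hc hI'
      refine ⟨m₂, fun ω S hS => .loop_true (by simp [ha']) (.seq ?_ (hr ω S hS)) (hr' ω S hS), hq⟩
      have e : (Exp.sub (cell a) (.lit 1)).eval m' = i := by simp [Exp.eval, ha']
      have := Runs.assign (a := .lit a) (e := .sub (cell a) (.lit 1)) (ω := ω) hm' ha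
        (by rw [e]; have := hm'.le a; omega) S hS
      rwa [e] at this
  exact main (m a) m le_rfl hm rfl h

/-! ### The algorithm -/

/-- The `n`-th power of an expression. -/
def Exp.pow (e : Exp) : ℕ → Exp
  | 0 => .lit 1
  | n + 1 => .mul (e.pow n) e

@[simp] lemma eval_pow (e : Exp) (n : ℕ) (m : Mem) : (e.pow n).eval m = e.eval m ^ n := by
  induction n with
  | zero => rfl
  | succ n ih => rw [pow_succ, ← ih]; rfl

/-- The number of repetitions of the sketch. -/
def repCount (κ k : ℕ) : ℕ := κ * k ^ 2

/-- The parameters `d` and `k = ⌈1 / ε⌉` are kept in the cells `4` and `5`. -/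
def gridExp (c : ℕ) : Exp :=
  .pow (.mul (.mul (.lit 2400) (cell 5)) (.pow (cell 4) (4 * c))) 2

def repExp (κ : ℕ) : Exp := .mul (.lit κ) (.pow (cell 5) 2)

@[simp] lemma eval_gridExp (c : ℕ) (m : Mem) : (gridExp c).eval m = gridSize c (m 4) (m 5) := by
  simp [gridExp, Exp.eval, gridSize]

@[simp] lemma eval_repExp (κ : ℕ) (m : Mem) : (repExp κ).eval m = repCount κ (m 5) := by
  simp [repExp, Exp.eval, repCount]

/-- A bound for the arguments of the hash function. -/
def hashDomain (c κ d k : ℕ) : ℕ := d * gridSize c d k ^ 2 * repCount κ k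

/-- Appends a coin toss to the seed in the cell `a`. -/
def seedProg (a : ℕ) : Prog :=
  .seq (.flip (.lit 11)) (.assign (.lit a) (.add (.mul (.lit 2) (cell a)) (cell 11)))

/-- The seeds are in the cells `7` to `10`, and the modulus of the hash function in the cell `6`. -/
def initProg (c κ : ℕ) : Prog :=
  .seq (.assign (.lit 4) (cell 0)) (.seq (.assign (.lit 5) (cell 1)) (.seq (.assign (.lit 6) (.lit 1))
    (.loop (.sub (.pow (.mul (.mul (cell 4) (.pow (gridExp c) 2)) (repExp κ)) 3) (cell 6))
      (.seq (.seq (seedProg 7) (.seq (seedProg 8) (.seq (seedProg 9) (seedProg 10))))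
        (.assign (.lit 6) (.mul (.lit 2) (cell 6)))))))

/-- Computes the coordinate of the embedding of `e` whose number is in the cell `12`, and stores it
in the cell `13`. -/
def embedProg (c : ℕ) (e : Exp) : Prog :=
  .seq (.assign (.lit 13) (.lit 0)) (.seq (.assign (.lit 14) (.pow (gridExp c) 3))
    (.seq (.assign (.lit 15) e) (.countdown 15
      (.seq (.assign (.lit 13) (.add (cell 13) (cell 14)))
        (.assign (.lit 14) (.div (.mul (cell 14) (cell 12)) (.pow (gridExp c) 2)))))))

def codeExp (c κ : ℕ) : Exp :=
  .add (.mul (.add (.mul (cell 1) (.pow (gridExp c) 2)) (cell 12)) (repExp κ)) (cell 16)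

/-- The hash value of `x` before the reduction modulo `m 6`, for the seeds in the memory `m`. -/
def memHash (m : Mem) (x : ℕ) : ℕ := m 7 + m 8 * x + m 9 * x ^ 2 + m 10 * x ^ 3

def hashExp (x : Exp) : Exp :=
  .add (.add (.add (cell 7) (.mul (cell 8) x)) (.mul (cell 9) (.pow x 2))) (.mul (cell 10) (.pow x 3))

def modTwoExp (e : Exp) : Exp := .sub e (.mul (.div e (.lit 2)) (.lit 2))

@[simp] lemma eval_hashExp (x : Exp) (m : Mem) : (hashExp x).eval m = memHash m (x.eval m) := by
  simp [hashExp, memHash, Exp.eval]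

@[simp] lemma eval_modTwoExp (e : Exp) (m : Mem) : (modTwoExp e).eval m = e.eval m % 2 := by
  simp only [modTwoExp, Exp.eval]; omega

/-- The sketch cell (of the repetition in the cell `16`) to which a coordinate is added. -/
def sketchExp (c κ : ℕ) : Exp :=
  .add (.add (.lit 32) (.mul (.lit 2) (cell 16)))
    (modTwoExp (.add (.div (hashExp (codeExp c κ)) (.div (cell 6) (.lit 2))) (cell 0)))

def updateProg (c κ : ℕ) : Prog :=
  .seq (.assign (.lit 12) (.pow (gridExp c) 2)) (.countdown 12
    (.seq (embedProg c (.div (.mul (cell 2) (gridExp c)) (cell 3)))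
      (.seq (.assign (.lit 16) (repExp κ)) (.countdown 16
        (.assign (sketchExp c κ) (.add (.read (sketchExp c κ)) (cell 13)))))))

/-- The squared difference of the two sketch cells of the repetition in the cell `16`. -/
def sqDiffExp : Exp :=
  let x : Exp := .read (.add (.lit 32) (.mul (.lit 2) (cell 16)))
  let y : Exp := .read (.add (.add (.lit 32) (.mul (.lit 2) (cell 16))) (.lit 1))
  .pow (.add (.sub x y) (.sub y x)) 2

def finishProg (c κ : ℕ) : Prog :=
  .seq (.assign (.lit 17) (.lit 0)) (.seq (.assign (.lit 16) (repExp κ))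
    (.seq (.countdown 16 (.assign (.lit 17) (.add (cell 17) sqDiffExp)))
      (.seq (.assign (.lit 18) (.lit 0)) (.seq (.assign (.lit 12) (.pow (gridExp c) 2))
        (.seq (.countdown 12 (.seq (embedProg c (gridExp c))
            (.assign (.lit 18) (.add (cell 18) (.pow (cell 13) 2)))))
          (.seq (.assign (.lit 0) (cell 17)) (.assign (.lit 1) (.mul (repExp κ) (cell 18)))))))))

def algorithm (c κ : ℕ) : Algorithm := ⟨initProg c κ, updateProg c κ, finishProg c κ⟩

/-! ### Correctness of the program parts -/

/-- The bound `V` for the contents of the cells is large enough. -/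
structure Ample (c κ d k V : ℕ) : Prop where
  one : 1 ≤ V
  dim : d ≤ V
  par : k ≤ V
  den : d ^ c ≤ V
  grid : gridSize c d k ≤ V
  grid_sq : gridSize c d k ^ 2 ≤ V
  scale : gridSize c d k ^ 3 ≤ V
  embed : gridSize c d k ^ 3 * gridSize c d k ≤ V
  rep : repCount κ k ≤ V
  modulus : 2 * hashDomain c κ d k ^ 3 ≤ V
  sketch : 2 * d * (gridSize c d k ^ 2 * (gridSize c d k ^ 3 * gridSize c d k)) ≤ V
  sum : repCount κ k *
    (2 * d * (gridSize c d k ^ 2 * (gridSize c d k ^ 3 * gridSize c d k))) ^ 2 ≤ V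
  norm : gridSize c d k ^ 2 * (gridSize c d k ^ 3 * gridSize c d k) ^ 2 ≤ V
  output : repCount κ k * (gridSize c d k ^ 2 * (gridSize c d k ^ 3 * gridSize c d k) ^ 2) ≤ V

section Correctness

variable {c κ d k : ℕ}

lemma ensures_embedProg (hV : Ample c κ d k V) (hA : 32 ≤ A) {e : Exp} {m : Mem} {X : ℕ}
    (hm : Bounded A V m) (h4 : m 4 = d) (h5 : m 5 = k) (h12 : m 12 < gridSize c d k ^ 2)
    (he : ∀ m' : Mem, (∀ b, b ≠ 13 → b ≠ 14 → b ≠ 15 → m' b = m b) → e.eval m' = X)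
    (hX : X ≤ gridSize c d k) :
    Ensures A V (embedProg c e) m fun m' => Bounded A V m' ∧
      (∀ b, b ≠ 13 → b ≠ 14 → b ≠ 15 → m' b = m b) ∧
      m' 13 = embed (gridSize c d k ^ 3) (gridSize c d k ^ 2) (m 12) X := by
  set M := gridSize c d k with hM
  refine .assign_seq hm (by simp; omega) (by simp) fun hm₁ => ?_
  refine .assign_seq hm₁ (by simp; omega) (by simp [h4, h5, ← hM]; exact hV.scale) fun hm₂ => ?_
  refine .assign_seq hm₂ (by simp; omega) ?_ fun hm₃ => ?_
  · rw [he _ (by intro b h1 h2 h3; simp [h1, h2])]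
    exact hX.trans hV.grid
  rw [he _ (by intro b h1 h2 h3; simp [h1, h2])] at hm₃ ⊢
  refine (Ensures.countdown (fun i m' => (∀ b, b ≠ 13 → b ≠ 14 → b ≠ 15 → m' b = m b) ∧
    m' 13 = embed (M ^ 3) (M ^ 2) (m 12) (X - i) ∧
    m' 14 = powApprox (M ^ 3) (M ^ 2) (m 12) (X - i)) (by omega) hm₃ ?_ ?_).mono ?_
  · refine ⟨?_, ?_, ?_⟩
    · intro b h1 h2 h3
      simp [h1, h2, h3]
    · simp [embed]
    · simp [powApprox, h4, h5, ← hM]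
  · intro i m' hi hm' h15 ⟨hf, h13, h14⟩
    simp only [Exp.eval, Finsupp.coe_update, Function.update_self] at hi
    have e : X - i = X - (i + 1) + 1 := by omega
    have hval : m' 13 + m' 14 = embed (M ^ 3) (M ^ 2) (m 12) (X - i) := by
      rw [h13, h14, e, embed, embed, Finset.sum_range_succ]
    have hval' : m' 14 * m 12 / M ^ 2 = powApprox (M ^ 3) (M ^ 2) (m 12) (X - i) := by
      rw [h14, e]; rfl
    have hm'' : Bounded A V (m'.update 15 i) := hm'.update (by omega) (by have := hm'.le 15; omega)
    have g4 : m' 4 = d := by rw [hf 4 (by omega) (by omega) (by omega), h4]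
    have g5 : m' 5 = k := by rw [hf 5 (by omega) (by omega) (by omega), h5]
    have g12 : m' 12 = m 12 := hf 12 (by omega) (by omega) (by omega)
    refine .assign_seq hm'' (by simp; omega) ?_ fun hm₄ => ?_
    · simp [Exp.eval, hval]
      exact (embed_le h12 _).trans ((Nat.mul_le_mul_left _ ((Nat.sub_le _ _).trans hX)).trans
        hV.embed)
    refine .assign hm₄ (by simp; omega) ?_ ?_
    · simp [Exp.eval, g4, g5, g12, ← hM, hval']
      exact (powApprox_le h12 _).trans hV.scale
    · refine ⟨hm₄.update (by simp; omega) ?_, ?_, ?_, ?_, ?_⟩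
      · simp [Exp.eval, g4, g5, g12, ← hM, hval']
        exact (powApprox_le h12 _).trans hV.scale
      · simp
      · intro b h1 h2 h3
        simp [h1, h2, h3, hf]
      · simp [Exp.eval, hval]
      · simp [Exp.eval, g4, g5, g12, ← hM, hval']
  · rintro m' ⟨hb, h15, hf, h13, h14⟩
    exact ⟨hb, hf, by simpa using h13⟩

/-- The number (`0` or `1`) of the cell of repetition `r` to which the coordinate `j` of the current
element is added. -/
def memBit (c κ d k : ℕ) (m : Mem) (j r : ℕ) : ℕ :=
  (memHash m ((m 1 * gridSize c d k ^ 2 + j) * repCount κ k + r) / (m 6 / 2) + m 0) % 2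

lemma memBit_congr {m m' : Mem} (h : ∀ b < 12, m' b = m b) (j r : ℕ) :
    memBit c κ d k m' j r = memBit c κ d k m j r := by
  unfold memBit memHash
  rw [h 0 (by omega), h 1 (by omega), h 6 (by omega), h 7 (by omega), h 8 (by omega),
    h 9 (by omega), h 10 (by omega)]

lemma memBit_lt (m : Mem) (j r : ℕ) : memBit c κ d k m j r < 2 := Nat.mod_lt _ (by norm_num)

lemma eval_sketchExp {m : Mem} (h4 : m 4 = d) (h5 : m 5 = k) :
    (sketchExp c κ).eval m = 32 + 2 * m 16 + memBit c κ d k m (m 12) (m 16) := by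
  simp [sketchExp, Exp.eval, memBit, codeExp, h4, h5]

lemma ensures_addToSketch (hV : Ample c κ d k V) (hA : A = 32 + 2 * repCount κ k) {m : Mem} {f : ℕ}
    (hm : Bounded A V m) (h4 : m 4 = d) (h5 : m 5 = k) (h13 : m 13 = f)
    (hf : ∀ r < repCount κ k, ∀ b < 2, m (32 + 2 * r + b) + f ≤ V) :
    Ensures A V (.seq (.assign (.lit 16) (repExp κ)) (.countdown 16
        (.assign (sketchExp c κ) (.add (.read (sketchExp c κ)) (cell 13))))) m fun m' =>
      Bounded A V m' ∧ (∀ b < 32, b ≠ 16 → m' b = m b) ∧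
      ∀ r < repCount κ k, ∀ b < 2, m' (32 + 2 * r + b) =
        m (32 + 2 * r + b) + if b = memBit c κ d k m (m 12) r then f else 0 := by
  refine .assign_seq hm (by simp; omega) (by simpa [h5] using hV.rep) fun hm₁ => ?_
  simp only [eval_lit, eval_repExp, h5] at hm₁ ⊢
  refine (Ensures.countdown (fun i m' => (∀ b < 32, b ≠ 16 → m' b = m b) ∧
    ∀ r < repCount κ k, ∀ b < 2, m' (32 + 2 * r + b) = m (32 + 2 * r + b) +
      if i ≤ r ∧ b = memBit c κ d k m (m 12) r then f else 0) (by omega) hm₁ ?_ ?_).mono ?_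
  · refine ⟨fun b _ h => by simp [h], fun r hr b hb => ?_⟩
    rw [Finsupp.coe_update, Function.update_of_ne (by omega), Function.update_self,
      if_neg (by omega), add_zero]
  · intro i m' hi hm' h16 ⟨hfr, hsk⟩
    simp only [Finsupp.coe_update, Function.update_self] at hi
    have hm₂ : Bounded A V (m'.update 16 i) := hm'.update (by omega) (by have := hm'.le 16; omega)
    have hfr' : ∀ b < 32, b ≠ 16 → (m'.update 16 i) b = m b := fun b hb hb' => by
      rw [Finsupp.coe_update, Function.update_of_ne hb', hfr b hb hb']
    have hbit : memBit c κ d k (m'.update 16 i) (m 12) i = memBit c κ d k m (m 12) i :=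
      memBit_congr (fun b hb => hfr' b (by omega) (by omega)) _ _
    have haddr : (sketchExp c κ).eval (m'.update 16 i) =
        32 + 2 * i + memBit c κ d k m (m 12) i := by
      rw [eval_sketchExp (d := d) (k := k) ((hfr' 4 (by omega) (by omega)).trans h4)
        ((hfr' 5 (by omega) (by omega)).trans h5), hfr' 12 (by omega) (by omega)]
      simp only [Finsupp.coe_update, Function.update_self]
      rw [hbit]
    have hlt := memBit_lt (c := c) (κ := κ) (d := d) (k := k) m (m 12) i
    have hval : (Exp.add (.read (sketchExp c κ)) (cell 13)).eval (m'.update 16 i) =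
        m (32 + 2 * i + memBit c κ d k m (m 12) i) + f := by
      simp only [Exp.eval, haddr, eval_cell]
      rw [hfr' 13 (by omega) (by omega), h13, Finsupp.coe_update,
        Function.update_of_ne (by omega), hsk i hi _ hlt, if_neg (by omega), add_zero]
    have hle := hf i hi _ hlt
    refine .assign hm₂ (by rw [haddr]; omega) (by rw [hval]; exact hle) ?_
    rw [haddr, hval]
    refine ⟨hm₂.update (by omega) hle, ?_, ?_, ?_⟩
    · rw [Finsupp.coe_update, Function.update_of_ne (by omega)]; simp
    · intro b hb hb'
      rw [Finsupp.coe_update, Function.update_of_ne (by omega), hfr' b hb hb']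
    · intro r hr b hb
      rw [Finsupp.coe_update, Function.update_apply]
      split_ifs with h1 h2 h2
      · rw [h1]
      · exfalso
        obtain rfl : r = i := by omega
        exact h2 ⟨le_rfl, by omega⟩
      · have h3 : r ≠ i := by
          rintro rfl
          exact h1 (by rw [h2.2])
        rw [Finsupp.coe_update, Function.update_of_ne (by omega), hsk r hr b hb,
          if_pos ⟨by omega, h2.2⟩]
      · rw [Finsupp.coe_update, Function.update_of_ne (by omega), hsk r hr b hb,
          if_neg fun h => h2 ⟨by omega, h.2⟩]
  · rintro m' ⟨hb, -, hfr, hsk⟩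
    refine ⟨hb, hfr, fun r hr b hb => ?_⟩
    simpa using hsk r hr b hb

lemma ensures_updateProg (hV : Ample c κ d k V) (hA : A = 32 + 2 * repCount κ k) {m : Mem} {X : ℕ}
    (hm : Bounded A V m) (h4 : m 4 = d) (h5 : m 5 = k) (hX : m 2 * gridSize c d k / m 3 = X)
    (hXM : X ≤ gridSize c d k)
    (hf : ∀ r < repCount κ k, ∀ b < 2, m (32 + 2 * r + b) +
      gridSize c d k ^ 2 * (gridSize c d k ^ 3 * gridSize c d k) ≤ V) :
    Ensures A V (updateProg c κ) m fun m' =>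
      Bounded A V m' ∧ (∀ b < 12, m' b = m b) ∧
      ∀ r < repCount κ k, ∀ b < 2, m' (32 + 2 * r + b) = m (32 + 2 * r + b) +
        ∑ j ∈ Finset.range (gridSize c d k ^ 2), if b = memBit c κ d k m j r then
          embed (gridSize c d k ^ 3) (gridSize c d k ^ 2) j X else 0 := by
  set M := gridSize c d k with hM
  refine .assign_seq hm (by simp; omega) (by simpa [h4, h5] using hV.grid_sq) fun hm₁ => ?_
  simp only [eval_lit, eval_pow, eval_gridExp, h4, h5, ← hM] at hm₁ ⊢
  refine (Ensures.countdown (fun i m' => (∀ b < 12, m' b = m b) ∧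
    ∀ r < repCount κ k, ∀ b < 2, m' (32 + 2 * r + b) = m (32 + 2 * r + b) +
      ∑ j ∈ Finset.Ico i (M ^ 2), if b = memBit c κ d k m j r then
          embed (M ^ 3) (M ^ 2) j X else 0) (by omega) hm₁ ?_ ?_).mono ?_
  · refine ⟨fun b hb => ?_, fun r hr b hb => ?_⟩
    · rw [Finsupp.coe_update, Function.update_of_ne (by omega)]
    · rw [Finsupp.coe_update, Function.update_of_ne (by omega), Function.update_self,
        Finset.Ico_self, Finset.sum_empty, add_zero]
  · intro i m' hi hm' h12 ⟨hfr, hsk⟩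
    simp only [Finsupp.coe_update, Function.update_self] at hi
    have hm₂ : Bounded A V (m'.update 12 i) := hm'.update (by omega) (by have := hm'.le 12; omega)
    have hfr' : ∀ b < 12, (m'.update 12 i) b = m b := fun b hb => by
      rw [Finsupp.coe_update, Function.update_of_ne (by omega), hfr b hb]
    have h12' : (m'.update 12 i) 12 = i := by simp
    have hsk' : ∀ r < repCount κ k, ∀ b < 2, (m'.update 12 i) (32 + 2 * r + b) =
        m (32 + 2 * r + b) + ∑ j ∈ Finset.Ico (i + 1) (M ^ 2),
          if b = memBit c κ d k m j r then embed (M ^ 3) (M ^ 2) j X else 0 := fun r hr b hb => by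
      rw [Finsupp.coe_update, Function.update_of_ne (by omega), hsk r hr b hb]
    generalize m'.update 12 i = m₂ at *
    have g4 : m₂ 4 = d := (hfr' 4 (by omega)).trans h4
    have g5 : m₂ 5 = k := (hfr' 5 (by omega)).trans h5
    refine .seq (ensures_embedProg hV (by omega) hm₂ g4 g5 (by rw [h12']; exact hi) (X := X) ?_ hXM)
      ?_
    · intro m₃ h₃
      simp only [Exp.eval, eval_cell, eval_gridExp, h₃ 2 (by omega) (by omega) (by omega),
        h₃ 3 (by omega) (by omega) (by omega), h₃ 4 (by omega) (by omega) (by omega),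
        h₃ 5 (by omega) (by omega) (by omega), g4, g5]
      rw [hfr' 2 (by omega), hfr' 3 (by omega), hX]
    rintro m₃ ⟨hm₃, h₃, h₃13⟩
    rw [h12', ← hM] at h₃13
    have hbound : ∀ r < repCount κ k, ∀ b < 2,
        m₃ (32 + 2 * r + b) + embed (M ^ 3) (M ^ 2) i X ≤ V := by
      intro r hr b hb
      rw [h₃ _ (by omega) (by omega) (by omega), hsk' r hr b hb, add_assoc]
      refine (Nat.add_le_add_left ?_ _).trans (hf r hr b hb)
      have h1 : ∀ j ∈ Finset.Ico (i + 1) (M ^ 2), (if b = memBit c κ d k m j r then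
          embed (M ^ 3) (M ^ 2) j X else 0) ≤ M ^ 3 * M := fun j hj => by
        split_ifs
        · exact (embed_le (Finset.mem_Ico.1 hj).2 X).trans (by gcongr)
        · exact Nat.zero_le _
      have h2 := Finset.sum_le_card_nsmul _ _ _ h1
      have h3 : embed (M ^ 3) (M ^ 2) i X ≤ M ^ 3 * M := (embed_le hi X).trans (by gcongr)
      rw [Nat.card_Ico, smul_eq_mul] at h2
      calc _ ≤ (M ^ 2 - (i + 1)) * (M ^ 3 * M) + 1 * (M ^ 3 * M) := by rw [one_mul]; gcongr
        _ = (M ^ 2 - (i + 1) + 1) * (M ^ 3 * M) := by rw [add_mul]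
        _ ≤ M ^ 2 * (M ^ 3 * M) := by gcongr; omega
    refine (ensures_addToSketch hV hA hm₃
      ((h₃ 4 (by omega) (by omega) (by omega)).trans g4)
      ((h₃ 5 (by omega) (by omega) (by omega)).trans g5) h₃13 hbound).mono ?_
    rintro m₄ ⟨hm₄, h₄, h₄sk⟩
    refine ⟨hm₄, ?_, ?_, ?_⟩
    · rw [h₄ 12 (by omega) (by omega), h₃ 12 (by omega) (by omega) (by omega), h12']
    · intro b hb
      rw [h₄ b (by omega) (by omega), h₃ b (by omega) (by omega) (by omega), hfr' b hb]
    · intro r hr b hb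
      have hbit : memBit c κ d k m₃ i r = memBit c κ d k m i r :=
        memBit_congr (fun b hb => by
          rw [h₃ b (by omega) (by omega) (by omega), hfr' b hb]) _ _
      rw [h₄sk r hr b hb, h₃ _ (by omega) (by omega) (by omega), hsk' r hr b hb,
        h₃ 12 (by omega) (by omega) (by omega), h12', hbit, Finset.sum_eq_sum_Ico_succ_bot hi]
      ring
  · rintro m' ⟨hb, -, hfr, hsk⟩
    refine ⟨hb, hfr, fun r hr b hb => ?_⟩
    rw [Finset.range_eq_Ico]
    exact hsk r hr b hb

/-- The squared difference of the two sketch cells of repetition `r`. -/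
def memSqDiff (m : Mem) (r : ℕ) : ℕ :=
  (m (32 + 2 * r) - m (32 + 2 * r + 1) + (m (32 + 2 * r + 1) - m (32 + 2 * r))) ^ 2

lemma eval_sqDiffExp (m : Mem) : sqDiffExp.eval m = memSqDiff m (m 16) := by
  simp [sqDiffExp, Exp.eval, memSqDiff]

lemma ensures_finishProg (hV : Ample c κ d k V) (hA : A = 32 + 2 * repCount κ k) {m : Mem}
    (hm : Bounded A V m) (h4 : m 4 = d) (h5 : m 5 = k)
    (hf : ∀ r < repCount κ k, ∀ b < 2, m (32 + 2 * r + b) ≤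
      2 * d * (gridSize c d k ^ 2 * (gridSize c d k ^ 3 * gridSize c d k))) :
    Ensures A V (finishProg c κ) m fun m' =>
      m' 0 = ∑ r ∈ Finset.range (repCount κ k), memSqDiff m r ∧
      m' 1 = repCount κ k * ∑ j ∈ Finset.range (gridSize c d k ^ 2),
        embed (gridSize c d k ^ 3) (gridSize c d k ^ 2) j (gridSize c d k) ^ 2 := by
  set M := gridSize c d k with hM
  set K := repCount κ k with hK
  have hsum : ∀ i, ∑ r ∈ Finset.Ico i K, memSqDiff m r ≤ V := by
    intro i
    have h1 : ∀ r ∈ Finset.Ico i K, memSqDiff m r ≤ (2 * d * (M ^ 2 * (M ^ 3 * M))) ^ 2 := by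
      intro r hr
      have hr := (Finset.mem_Ico.1 hr).2
      have a1 := hf r hr 0 (by omega)
      have a2 := hf r hr 1 (by omega)
      unfold memSqDiff
      refine Nat.pow_le_pow_left ?_ 2
      rw [add_zero] at a1
      omega
    refine (Finset.sum_le_card_nsmul _ _ _ h1).trans (le_trans ?_ hV.sum)
    rw [Nat.card_Ico, smul_eq_mul]
    exact Nat.mul_le_mul_right _ (Nat.sub_le _ _)
  have hnorm : ∀ i, ∑ j ∈ Finset.Ico i (M ^ 2), embed (M ^ 3) (M ^ 2) j M ^ 2 ≤
      M ^ 2 * (M ^ 3 * M) ^ 2 := by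
    intro i
    have h1 : ∀ j ∈ Finset.Ico i (M ^ 2), embed (M ^ 3) (M ^ 2) j M ^ 2 ≤ (M ^ 3 * M) ^ 2 :=
      fun j hj => Nat.pow_le_pow_left (embed_le (Finset.mem_Ico.1 hj).2 M) 2
    refine (Finset.sum_le_card_nsmul _ _ _ h1).trans ?_
    rw [Nat.card_Ico, smul_eq_mul]
    exact Nat.mul_le_mul_right _ (Nat.sub_le _ _)
  refine .assign_seq hm (by simp; omega) (by simp) fun hm₁ => ?_
  refine .assign_seq hm₁ (by simp; omega) (by simpa [h5] using hV.rep) fun hm₂ => ?_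
  simp only [eval_lit, eval_repExp] at hm₁ hm₂ ⊢
  have e5 : (m.update 17 0) 5 = k := by simpa using h5
  rw [e5, ← hK] at hm₂ ⊢
  refine .seq (Ensures.countdown (fun i m' => (∀ b, b ≠ 16 → b ≠ 17 → m' b = m b) ∧
    m' 17 = ∑ r ∈ Finset.Ico i K, memSqDiff m r) (by omega) hm₂ ?_ ?_) ?_
  · exact ⟨fun b h1 h2 => by simp [h1, h2], by simp⟩
  · intro i m' hi hm' h16 ⟨hfr, h17⟩
    simp only [Finsupp.coe_update, Function.update_self] at hi
    have hm₃ : Bounded A V (m'.update 16 i) := hm'.update (by omega) (by have := hm'.le 16; omega)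
    have hval : (Exp.add (cell 17) sqDiffExp).eval (m'.update 16 i) =
        ∑ r ∈ Finset.Ico i K, memSqDiff m r := by
      rw [Finset.sum_eq_sum_Ico_succ_bot hi, ← h17, add_comm]
      simp only [Exp.eval, eval_sqDiffExp, eval_cell, Finsupp.coe_update, Function.update_self]
      congr 1
      unfold memSqDiff
      rw [Finsupp.coe_update, Function.update_of_ne (by omega), Function.update_of_ne (by omega),
        hfr _ (by omega) (by omega), hfr _ (by omega) (by omega)]
    refine .assign hm₃ (by simp; omega) (by rw [hval]; exact hsum i) ?_
    rw [hval]
    refine ⟨hm₃.update (by simp; omega) (hsum i), by simp, fun b h1 h2 => ?_, by simp⟩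
    simp [h1, h2, hfr]
  rintro m₃ ⟨hm₃, -, hfr₃, h17⟩
  rw [← Finset.range_eq_Ico] at h17
  refine .assign_seq hm₃ (by simp; omega) (by simp) fun hm₄ => ?_
  have e4 : (m₃.update 18 0) 4 = d := by simpa using (hfr₃ 4 (by omega) (by omega)).trans h4
  have e5 : (m₃.update 18 0) 5 = k := by simpa using (hfr₃ 5 (by omega) (by omega)).trans h5
  have e17 : (m₃.update 18 0) 17 = ∑ r ∈ Finset.range K, memSqDiff m r := by simpa using h17
  have e18 : (m₃.update 18 0) 18 = 0 := by simp
  simp only [eval_lit] at hm₄ ⊢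
  generalize m₃.update 18 0 = m₄ at *
  refine .assign_seq hm₄ (by simp; omega) (by simpa [e4, e5] using hV.grid_sq) fun hm₅ => ?_
  simp only [eval_lit, eval_pow, eval_gridExp, e4, e5, ← hM] at hm₅ ⊢
  refine .seq (Ensures.countdown (fun i m' => m' 4 = d ∧ m' 5 = k ∧
    m' 17 = ∑ r ∈ Finset.range K, memSqDiff m r ∧
    m' 18 = ∑ j ∈ Finset.Ico i (M ^ 2), embed (M ^ 3) (M ^ 2) j M ^ 2) (by omega) hm₅ ?_ ?_) ?_
  · simp [e4, e5, e17, e18]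
  · intro i m' hi hm' h12 ⟨g4, g5, g17, g18⟩
    simp only [Finsupp.coe_update, Function.update_self] at hi
    have hm₆ : Bounded A V (m'.update 12 i) := hm'.update (by omega) (by have := hm'.le 12; omega)
    refine .seq (ensures_embedProg hV (by omega) hm₆ (by simpa using g4) (by simpa using g5)
      (by simpa using hi) (X := M) ?_ le_rfl) ?_
    · intro m₇ h₇
      rw [eval_gridExp, h₇ 4 (by omega) (by omega) (by omega), h₇ 5 (by omega) (by omega) (by omega)]
      simp [g4, g5, hM]
    rintro m₇ ⟨hm₇, h₇, h13⟩
    rw [← hM] at h13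
    simp only [Finsupp.coe_update, Function.update_self] at h13
    have hval : (Exp.add (cell 18) (.pow (cell 13) 2)).eval m₇ =
        ∑ j ∈ Finset.Ico i (M ^ 2), embed (M ^ 3) (M ^ 2) j M ^ 2 := by
      rw [Finset.sum_eq_sum_Ico_succ_bot hi, ← g18, add_comm]
      simp only [Exp.eval, eval_cell, eval_pow, h13]
      rw [h₇ 18 (by omega) (by omega) (by omega)]
      simp
    have hle := (hnorm i).trans hV.norm
    refine .assign hm₇ (by simp; omega) (by rw [hval]; exact hle) ?_
    rw [hval]
    refine ⟨hm₇.update (by simp; omega) hle, ?_, ?_, ?_, ?_, by simp⟩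
    · simp [h₇ 12 (by omega) (by omega) (by omega)]
    · simp [h₇ 4 (by omega) (by omega) (by omega), g4]
    · simp [h₇ 5 (by omega) (by omega) (by omega), g5]
    · simp [h₇ 17 (by omega) (by omega) (by omega), g17]
  rintro m₆ ⟨hm₆, -, g4, g5, g17, g18⟩
  rw [← Finset.range_eq_Ico] at g18
  refine .assign_seq hm₆ (by simp; omega) (by simpa using hm₆.le 17) fun hm₇ => ?_
  have hval : (Exp.mul (repExp κ) (cell 18)).eval (m₆.update ((Exp.lit 0).eval m₆)
      ((cell 17).eval m₆)) = K * ∑ j ∈ Finset.range (M ^ 2), embed (M ^ 3) (M ^ 2) j M ^ 2 := by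
    simp [Exp.eval, g5, g18, ← hK]
  refine .assign hm₇ (by simp; omega) ?_ ?_
  · rw [hval, Finset.range_eq_Ico]
    exact (Nat.mul_le_mul_left _ (hnorm 0)).trans hV.output
  · rw [hval]
    simp [g17]

lemma runs_seedProg {m : Mem} {ω : ℕ → Bool} {a : ℕ} (hA : 32 ≤ A) (ha : a < 32) (ha' : a ≠ 11)
    (hm : Bounded A V m) (hV : 1 ≤ V) (h : 2 * m a + 1 ≤ V) :
    ∃ m', Runs A V (seedProg a) ⟨m, ω⟩ ⟨m', fun n => ω (n + 1)⟩ ∧ Bounded A V m' ∧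
      (∀ b, b ≠ 11 → b ≠ a → m' b = m b) ∧ m' a = 2 * m a + (ω 0).toNat := by
  have hb := Bool.toNat_le (ω 0)
  have hm₁ : Bounded A V (m.update 11 (ω 0).toNat) := hm.update (by omega) (by omega)
  have e : (Exp.add (.mul (.lit 2) (cell a)) (cell 11)).eval (m.update 11 (ω 0).toNat) =
      2 * m a + (ω 0).toNat := by
    simp [Exp.eval, ha']
  refine ⟨_, (Runs.flip hm (by simp; omega) hV).seq
    (Runs.assign hm₁ (by simp; omega) (by rw [eval_lit, e]; omega)), ?_⟩
  simp only [e, eval_lit]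
  exact ⟨hm₁.update (by omega) (by omega), fun b h1 h2 => by simp [h1, h2], by simp⟩

/-- The configuration when the modulus is `2 ^ n`. -/
structure Seeded (A V d k : ℕ) (ω : ℕ → Bool) (n : ℕ) (m : Mem) : Prop where
  bounded : Bounded A V m
  dim : m 4 = d
  par : m 5 = k
  modulus : m 6 = 2 ^ n
  seed : ∀ j < 4, m (7 + j) = seedVal ω j n

lemma runs_initProg (hV : Ample c κ d k V) (hA : 32 ≤ A) {m : Mem} (ω : ℕ → Bool)
    (hm : Bounded A V m) (h0 : m 0 = d) (h1 : m 1 = k) (hz : ∀ a, 2 ≤ a → m a = 0) :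
    ∃ m' ω', Runs A V (initProg c κ) ⟨m, ω⟩ ⟨m', ω'⟩ ∧
      Seeded A V d k ω (Nat.clog 2 (hashDomain c κ d k ^ 3)) m' ∧ ∀ a, 32 ≤ a → m' a = 0 := by
  set T := hashDomain c κ d k ^ 3 with hT
  have eT {m : Mem} (h4 : m 4 = d) (h5 : m 5 = k) :
      (Exp.pow (.mul (.mul (cell 4) (.pow (gridExp c) 2)) (repExp κ)) 3).eval m = T := by
    simp [Exp.eval, h4, h5, hT, hashDomain]
  have hTV : 2 * T ≤ V := hV.modulus
  have main : ∀ t n m, n + t = Nat.clog 2 T → Seeded A V d k ω n m → (∀ a, 32 ≤ a → m a = 0) →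
      ∃ m' ω', Runs A V
        (.loop (.sub (.pow (.mul (.mul (cell 4) (.pow (gridExp c) 2)) (repExp κ)) 3) (cell 6))
          (.seq (.seq (seedProg 7) (.seq (seedProg 8) (.seq (seedProg 9) (seedProg 10))))
            (.assign (.lit 6) (.mul (.lit 2) (cell 6)))))
        ⟨m, fun i => ω (4 * n + i)⟩ ⟨m', ω'⟩ ∧ Seeded A V d k ω (Nat.clog 2 T) m' ∧
        ∀ a, 32 ≤ a → m' a = 0 := by
    intro t
    induction t with
    | zero =>
      intro n m hn hs hz
      obtain rfl : n = Nat.clog 2 T := by omega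
      refine ⟨m, _, fun S hS => .loop_false ?_ (hS m hs.bounded), hs, hz⟩
      simp only [Exp.eval]
      rw [eT hs.dim hs.par, eval_cell, hs.modulus, Nat.sub_eq_zero_iff_le]
      exact Nat.le_pow_clog (by norm_num) T
    | succ t ih =>
      intro n m hn hs hz
      have hlt : 2 ^ n < T := (Nat.lt_clog_iff_pow_lt (by norm_num)).1 (by omega)
      have hseed : ∀ j < 4, 2 * m (7 + j) + 1 ≤ V := fun j hj => by
        rw [hs.seed j hj]
        have := seedVal_lt ω j n
        omega
      have s7 := hs.seed 0 (by omega)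
      have s8 := hs.seed 1 (by omega)
      have s9 := hs.seed 2 (by omega)
      have s10 := hs.seed 3 (by omega)
      obtain ⟨m₁, r₁, b₁, f₁, v₁⟩ := runs_seedProg (ω := fun i => ω (4 * n + i)) (a := 7) hA
        (by omega) (by omega) hs.bounded hV.one (hseed 0 (by omega))
      obtain ⟨m₂, r₂, b₂, f₂, v₂⟩ := runs_seedProg (ω := fun i => ω (4 * n + (i + 1))) (a := 8) hA
        (by omega) (by omega) b₁ hV.one
        (by rw [f₁ 8 (by omega) (by omega)]; exact hseed 1 (by omega))
      obtain ⟨m₃, r₃, b₃, f₃, v₃⟩ := runs_seedProg (ω := fun i => ω (4 * n + (i + 1 + 1))) (a := 9) hA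
        (by omega) (by omega) b₂ hV.one
        (by rw [f₂ 9 (by omega) (by omega), f₁ 9 (by omega) (by omega)]; exact hseed 2 (by omega))
      obtain ⟨m₄, r₄, b₄, f₄, v₄⟩ := runs_seedProg (ω := fun i => ω (4 * n + (i + 1 + 1 + 1)))
        (a := 10) hA (by omega) (by omega) b₃ hV.one
        (by rw [f₃ 10 (by omega) (by omega), f₂ 10 (by omega) (by omega),
              f₁ 10 (by omega) (by omega)]; exact hseed 3 (by omega))
      have fr : ∀ b, b ≠ 7 → b ≠ 8 → b ≠ 9 → b ≠ 10 → b ≠ 11 → m₄ b = m b :=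
        fun b h7 h8 h9 h10 h11 => by
          rw [f₄ b h11 h10, f₃ b h11 h9, f₂ b h11 h8, f₁ b h11 h7]
      have e6 : (Exp.mul (.lit 2) (cell 6)).eval m₄ = 2 ^ (n + 1) := by
        simp only [Exp.eval, eval_cell]
        rw [fr 6 (by omega) (by omega) (by omega) (by omega) (by omega), hs.modulus, pow_succ']
      have le6 : 2 ^ (n + 1) ≤ V := by rw [pow_succ']; omega
      have r₅ := Runs.assign (A := A) (V := V) (a := .lit 6) (e := .mul (.lit 2) (cell 6))
        (ω := fun i => ω (4 * n + (i + 1 + 1 + 1 + 1))) b₄ (by simp; omega)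
        (by rw [e6]; exact le6)
      rw [e6, eval_lit] at r₅
      have ec : (fun i => ω (4 * n + (i + 1 + 1 + 1 + 1))) = fun i => ω (4 * (n + 1) + i) := by
        funext i; congr 1; ring
      have hs' : Seeded A V d k ω (n + 1) (m₄.update 6 (2 ^ (n + 1))) := by
        refine ⟨b₄.update (by omega) le6, ?_, ?_, by simp, fun j hj => ?_⟩
        · simp [fr, hs.dim]
        · simp [fr, hs.par]
        · rw [Finsupp.coe_update, Function.update_of_ne (by omega)]
          interval_cases j
          · rw [f₄ _ (by omega) (by omega), f₃ _ (by omega) (by omega),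
              f₂ _ (by omega) (by omega), v₁, s7]; rfl
          · rw [f₄ _ (by omega) (by omega), f₃ _ (by omega) (by omega), v₂,
              f₁ _ (by omega) (by omega), s8]; rfl
          · rw [f₄ _ (by omega) (by omega), v₃, f₂ _ (by omega) (by omega),
              f₁ _ (by omega) (by omega), s9]; rfl
          · rw [v₄, f₃ _ (by omega) (by omega), f₂ _ (by omega) (by omega),
              f₁ _ (by omega) (by omega), s10]; rfl
      obtain ⟨m', ω', r, hs'', hz'⟩ := ih (n + 1) _ (by omega) hs' fun a ha => by
        rw [Finsupp.coe_update, Function.update_of_ne (by omega),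
          fr a (by omega) (by omega) (by omega) (by omega) (by omega), hz a ha]
      refine ⟨m', ω', fun S hS => .loop_true ?_
        (((r₁.seq (r₂.seq (r₃.seq r₄))).seq r₅) S hS) (ec ▸ r S hS), hs'', hz'⟩
      simp only [Exp.eval]
      rw [eT hs.dim hs.par, eval_cell, hs.modulus]
      omega
  have r₁ := Runs.assign (A := A) (V := V) (a := .lit 4) (e := cell 0) (ω := ω) hm (by simp; omega)
    (hm.le 0)
  have b₁ : Bounded A V (m.update 4 d) := hm.update (by omega) hV.dim
  rw [eval_lit, eval_cell, h0] at r₁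
  have e1 : (cell 1).eval (m.update 4 d) = k := by simp [h1]
  have r₂ := Runs.assign (A := A) (V := V) (a := .lit 5) (e := cell 1) (ω := ω) b₁ (by simp; omega)
    (b₁.le 1)
  have b₂ : Bounded A V ((m.update 4 d).update 5 k) := b₁.update (by omega) hV.par
  rw [eval_lit, e1] at r₂
  have r₃ := Runs.assign (A := A) (V := V) (a := .lit 6) (e := .lit 1) (ω := ω) b₂ (by simp; omega)
    hV.one
  rw [eval_lit, eval_lit] at r₃
  obtain ⟨m', ω', r, hs, hz'⟩ := main (Nat.clog 2 T) 0 (((m.update 4 d).update 5 k).update 6 1)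
    (by omega) ⟨b₂.update (by omega) hV.one, by simp, by simp, by simp, fun j hj => by
      rw [Finsupp.coe_update, Function.update_of_ne (by omega), Finsupp.coe_update,
        Function.update_of_ne (by omega), Finsupp.coe_update, Function.update_of_ne (by omega),
        hz _ (by omega)]; rfl⟩ fun a ha => by
      rw [Finsupp.coe_update, Function.update_of_ne (by omega), Finsupp.coe_update,
        Function.update_of_ne (by omega), Finsupp.coe_update, Function.update_of_ne (by omega),
        hz _ (by omega)]
  refine ⟨m', ω', r₁.seq (r₂.seq (r₃.seq ?_)), hs, hz'⟩
  simpa using r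

/-! ### The pass over the stream -/

/-- The argument of the hash function for coordinate `j` of the embedding of the value with index
`i`, in repetition `r`. -/
def hashCode (c κ d k i j r : ℕ) : ℕ := (i * gridSize c d k ^ 2 + j) * repCount κ k + r

/-- What a stream element adds to the cell `b` of repetition `r`. -/
def contribution (c κ k : ℕ) {n d : ℕ} (s : Fin 4 → ZMod (2 ^ (n + 1))) (r b : ℕ) (x : Item d) : ℕ :=
  ∑ j ∈ Finset.range (gridSize c d k ^ 2),
    if b = (topBit (hashVal s (hashCode c κ d k x.index j r)) + x.second.toNat) % 2 then
      embed (gridSize c d k ^ 3) (gridSize c d k ^ 2) j (gridIndex (gridSize c d k) x.value) else 0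

/-- An element whose value is a probability of precision `d ^ c`. -/
structure Item.Valid (c : ℕ) {d : ℕ} (x : Item d) : Prop where
  nonneg : 0 ≤ x.value
  le_one : x.value ≤ 1
  den_le : x.value.den ≤ d ^ c

lemma contribution_le {n : ℕ} (s : Fin 4 → ZMod (2 ^ (n + 1))) (r b : ℕ) {x : Item d}
    (hx : x.Valid c) : contribution c κ k s r b x ≤
      gridSize c d k ^ 2 * (gridSize c d k ^ 3 * gridSize c d k) := by
  unfold contribution
  refine (Finset.sum_le_card_nsmul _ _ (gridSize c d k ^ 3 * gridSize c d k)
    fun j hj => ?_).trans (by simp)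
  split_ifs
  · exact (embed_le (Finset.mem_range.1 hj) _).trans
      (Nat.mul_le_mul_left _ (gridIndex_le _ hx.nonneg hx.le_one))
  · exact Nat.zero_le _

lemma memBit_eq {n : ℕ} {ω : ℕ → Bool} {m : Mem} (h6 : m 6 = 2 ^ (n + 1))
    (hs : ∀ j < 4, m (7 + j) = seedVal ω j (n + 1)) (j r : ℕ) :
    memBit c κ d k m j r =
      (topBit (hashVal (seeds (n + 1) ω) (hashCode c κ d k (m 1) j r)) + m 0) % 2 := by
  unfold memBit
  change (memHash m (hashCode c κ d k (m 1) j r) / (m 6 / 2) + m 0) % 2 = _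
  generalize hashCode c κ d k (m 1) j r = x
  have e : hashVal (seeds (n + 1) ω) x = (memHash m x : ZMod (2 ^ (n + 1))) := by
    have h0 := hs 0 (by omega)
    have h1 := hs 1 (by omega)
    have h2 := hs 2 (by omega)
    have h3 := hs 3 (by omega)
    simp only [Nat.add_zero, Nat.reduceAdd] at h0 h1 h2 h3
    simp only [memHash, hashVal, seeds, h0, h1, h2, h3]
    push_cast
    rfl
  have e2 : topBit (hashVal (seeds (n + 1) ω) x) = memHash m x / 2 ^ n % 2 := by
    rw [e, topBit, ZMod.val_natCast, pow_succ, Nat.mod_mul_right_div_self]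
  rw [e2, h6, pow_succ, Nat.mul_div_cancel _ (by norm_num), Nat.mod_add_mod]

lemma Item.load_apply {d : ℕ} (x : Item d) (m : Mem) {a : ℕ} (ha : 4 ≤ a) : x.load m a = m a := by
  unfold Item.load
  rw [Finsupp.coe_update, Function.update_of_ne (by omega), Finsupp.coe_update,
    Function.update_of_ne (by omega), Finsupp.coe_update, Function.update_of_ne (by omega),
    Finsupp.coe_update, Function.update_of_ne (by omega)]

lemma Item.Valid.num_le {x : Item d} (hx : x.Valid c) : x.value.num.natAbs ≤ x.value.den := by
  have h1 := Rat.num_le_denom_iff.2 hx.le_one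
  have h2 := Rat.num_nonneg.2 hx.nonneg
  omega

lemma Item.Valid.load_bounded {x : Item d} (hx : x.Valid c) (hV : Ample c κ d k V) (hA : 32 ≤ A)
    {m : Mem} (hm : Bounded A V m) : Bounded A V (x.load m) := by
  have h1 := hx.den_le.trans hV.den
  exact (((hm.update (by omega) ((Bool.toNat_le _).trans hV.one)).update (by omega)
    (x.index.2.le.trans hV.dim)).update (by omega) (hx.num_le.trans h1)).update (by omega) h1

lemma pass_updateProg (hV : Ample c κ d k V) (hA : A = 32 + 2 * repCount κ k) {n : ℕ}
    {ω : ℕ → Bool} (l : List (Item d)) (hl : ∀ x ∈ l, x.Valid c) {m : Mem}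
    (hm : Seeded A V d k ω (n + 1) m)
    (hf : ∀ r < repCount κ k, ∀ b < 2, m (32 + 2 * r + b) +
      l.length * (gridSize c d k ^ 2 * (gridSize c d k ^ 3 * gridSize c d k)) ≤ V) :
    ∃ m', (∀ S, Suffices A V S → ∀ ω', Pass S (updateProg c κ) l ⟨m, ω'⟩ ⟨m', ω'⟩) ∧
      Seeded A V d k ω (n + 1) m' ∧ ∀ r < repCount κ k, ∀ b < 2, m' (32 + 2 * r + b) =
        m (32 + 2 * r + b) + (l.map (contribution c κ k (seeds (n + 1) ω) r b)).sum := by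
  induction l generalizing m with
  | nil => exact ⟨m, fun _ _ _ => .nil, hm, by simp⟩
  | cons x l ih =>
    have hx := hl x (by simp)
    rw [List.length_cons] at hf
    have hld := hx.load_bounded hV (by omega) hm.bounded
    have l4 {a : ℕ} (ha : 4 ≤ a) := x.load_apply m ha
    obtain ⟨m₁, hr, hb, hfr, hsk⟩ := ensures_updateProg hV hA hld
      (X := gridIndex (gridSize c d k) x.value) ((l4 (by omega)).trans hm.dim)
      ((l4 (by omega)).trans hm.par) (by simp [Item.load, gridIndex])
      (gridIndex_le _ hx.nonneg hx.le_one) (fun r hr b hb => by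
        rw [l4 (by omega)]
        refine le_trans ?_ (hf r hr b hb)
        rw [add_mul, one_mul]
        omega)
    have hseed : ∀ j < 4, x.load m (7 + j) = seedVal ω j (n + 1) :=
      fun j hj => (l4 (by omega)).trans (hm.seed j hj)
    have hm₁ : Seeded A V d k ω (n + 1) m₁ :=
      ⟨hb, (hfr 4 (by omega)).trans ((l4 (by omega)).trans hm.dim),
        (hfr 5 (by omega)).trans ((l4 (by omega)).trans hm.par),
        (hfr 6 (by omega)).trans ((l4 (by omega)).trans hm.modulus),
        fun j hj => (hfr (7 + j) (by omega)).trans (hseed j hj)⟩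
    have hsk' : ∀ r < repCount κ k, ∀ b < 2, m₁ (32 + 2 * r + b) =
        m (32 + 2 * r + b) + contribution c κ k (seeds (n + 1) ω) r b x := fun r hr b hb => by
      rw [hsk r hr b hb, l4 (by omega)]
      unfold contribution
      congr 1
      refine Finset.sum_congr rfl fun j _ => ?_
      rw [memBit_eq ((l4 (by omega)).trans hm.modulus) hseed]
      simp [Item.load]
    obtain ⟨m₂, hp, hs, hsk₂⟩ := ih (fun y hy => hl y (by simp [hy])) hm₁ fun r hr b hb => by
      rw [hsk' r hr b hb]
      have h1 := contribution_le (κ := κ) (k := k) (seeds (n + 1) ω) r b hx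
      have h2 := hf r hr b hb
      rw [add_mul, one_mul] at h2
      omega
    refine ⟨m₂, fun S hS ω' => .cons (hr ω' S hS) (hp S hS ω'), hs, fun r hr b hb => ?_⟩
    rw [hsk₂ r hr b hb, hsk' r hr b hb, List.map_cons, List.sum_cons, add_assoc]

end Correctness

/-! ### Accuracy of the estimate -/

section Accuracy

variable {c κ d k n : ℕ}

lemma hashCode_lt {i j r : ℕ} (hi : i < d) (hj : j < gridSize c d k ^ 2) (hr : r < repCount κ k) :
    hashCode c κ d k i j r < hashDomain c κ d k := by
  unfold hashCode hashDomain
  have h1 : i * gridSize c d k ^ 2 + j + 1 ≤ d * gridSize c d k ^ 2 :=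
    calc _ ≤ i * gridSize c d k ^ 2 + gridSize c d k ^ 2 := by omega
      _ = (i + 1) * gridSize c d k ^ 2 := by ring
      _ ≤ _ := Nat.mul_le_mul_right _ hi
  have h2 := Nat.mul_le_mul_right (repCount κ k) h1
  rw [add_mul, one_mul] at h2
  omega

lemma hashCode_inj {i j r i' j' r' : ℕ} (hj : j < gridSize c d k ^ 2) (hr : r < repCount κ k)
    (hj' : j' < gridSize c d k ^ 2) (hr' : r' < repCount κ k)
    (h : hashCode c κ d k i j r = hashCode c κ d k i' j' r') : i = i' ∧ j = j' ∧ r = r' := by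
  unfold hashCode at h
  have split {a b a' b' q : ℕ} (hb : b < q) (hb' : b' < q) (h : a * q + b = a' * q + b') :
      a = a' ∧ b = b' := by
    have h1 := congrArg (· / q) h
    have h2 := congrArg (· % q) h
    simp only [Nat.mul_add_mod_self_right, Nat.mod_eq_of_lt hb, Nat.mod_eq_of_lt hb'] at h2
    rw [mul_comm a, mul_comm a'] at h1
    simp only [Nat.mul_add_div (Nat.zero_lt_of_lt hb), Nat.div_eq_of_lt hb, Nat.div_eq_of_lt hb',
      add_zero] at h1
    exact ⟨h1, h2⟩
  obtain ⟨h1, h2⟩ := split hr hr' h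
  obtain ⟨h3, h4⟩ := split hj hj' h1
  exact ⟨h3, h4, h2⟩

/-- The vector that is sketched. -/
noncomputable def embedDiff (c k : ℕ) {d : ℕ} (p q : Fin d → ℚ)
    (a : Fin d × Fin (gridSize c d k ^ 2)) : ℝ :=
  (embed (gridSize c d k ^ 3) (gridSize c d k ^ 2) a.2 (gridIndex (gridSize c d k) (p a.1)) : ℝ) -
    embed (gridSize c d k ^ 3) (gridSize c d k ^ 2) a.2 (gridIndex (gridSize c d k) (q a.1))

lemma sum_embedDiff_sq (p q : Fin d → ℚ) : ∑ a, embedDiff c k p q a ^ 2 =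
    ∑ i, embedDist (gridSize c d k ^ 3) (gridSize c d k ^ 2) (gridIndex (gridSize c d k) (p i))
      (gridIndex (gridSize c d k) (q i)) := by
  rw [Fintype.sum_prod_type]
  refine Finset.sum_congr rfl fun i _ => ?_
  rw [embedDist, Finset.sum_range]
  rfl

lemma contribution_sub (s : Fin 4 → ZMod (2 ^ (n + 1))) (r : ℕ) (x : Item d) :
    (contribution c κ k s r 0 x : ℝ) - contribution c κ k s r 1 x =
      ∑ j : Fin (gridSize c d k ^ 2), (-1) ^ x.second.toNat *
        ((embed (gridSize c d k ^ 3) (gridSize c d k ^ 2) j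
          (gridIndex (gridSize c d k) x.value) : ℝ) *
        hashSign s (hashCode c κ d k x.index j r)) := by
  unfold contribution
  push_cast
  rw [← Finset.sum_sub_distrib, Finset.sum_range]
  refine Finset.sum_congr rfl fun j _ => ?_
  unfold hashSign
  rw [mul_left_comm, ← pow_add, add_comm x.second.toNat]
  generalize topBit _ + x.second.toNat = t
  rcases Nat.even_or_odd t with h | h
  · rw [h.neg_one_pow, Nat.even_iff.1 h]; simp
  · rw [h.neg_one_pow, Nat.odd_iff.1 h]; simp

lemma sum_map_of_isAggregateStream {p q : Fin d → ℚ} {l : List (Item d)}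
    (h : IsAggregateStream p q l) (f : Item d → ℝ) :
    (l.map f).sum = ∑ i, f ⟨false, i, p i⟩ + ∑ i, f ⟨true, i, q i⟩ := by
  rw [(h.map f).sum_eq, List.map_append, List.sum_append, List.map_map, List.map_map,
    Fin.sum_univ_def, Fin.sum_univ_def]
  rfl

lemma sketch_sub {p q : Fin d → ℚ} {l : List (Item d)}
    (h : IsAggregateStream p q l) (s : Fin 4 → ZMod (2 ^ (n + 1))) (r : ℕ) :
    ((l.map (contribution c κ k s r 0)).sum : ℝ) - (l.map (contribution c κ k s r 1)).sum =
      ∑ a : Fin d × Fin (gridSize c d k ^ 2),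
        embedDiff c k p q a * hashSign s (hashCode c κ d k a.1 a.2 r) := by
  have e (b : ℕ) : ((l.map (contribution c κ k s r b)).sum : ℝ) =
      (l.map fun x => (contribution c κ k s r b x : ℝ)).sum := by
    rw [Nat.cast_list_sum, List.map_map]; rfl
  rw [e, e, sum_map_of_isAggregateStream h, sum_map_of_isAggregateStream h, add_sub_add_comm,
    ← Finset.sum_sub_distrib, ← Finset.sum_sub_distrib, ← Finset.sum_add_distrib,
    Fintype.sum_prod_type]
  refine Finset.sum_congr rfl fun i _ => ?_
  rw [contribution_sub, contribution_sub, ← Finset.sum_add_distrib]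
  refine Finset.sum_congr rfl fun j _ => ?_
  simp only [embedDiff, Bool.toNat_false, Bool.toNat_true]
  ring

/-- The sum of the squared sketches. -/
noncomputable def sketchEnergy (c κ k : ℕ) {d n : ℕ} (p q : Fin d → ℚ)
    (s : Fin 4 → ZMod (2 ^ (n + 1))) : ℝ :=
  ∑ r : Fin (repCount κ k), (∑ a : Fin d × Fin (gridSize c d k ^ 2),
    embedDiff c k p q a * hashSign s (hashCode c κ d k a.1 a.2 r)) ^ 2

/-- The seeds for which the sketch misestimates the squared norm. -/
noncomputable def badSeeds (c κ k n : ℕ) {d : ℕ} (p q : Fin d → ℚ) :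
    Finset (Fin 4 → ZMod (2 ^ (n + 1))) :=
  Finset.univ.filter fun s => 1 / (10 * k) * (repCount κ k * ∑ a, embedDiff c k p q a ^ 2) <
    |sketchEnergy c κ k p q s - repCount κ k * ∑ a, embedDiff c k p q a ^ 2|

lemma card_badSeeds_le (hk : 0 < k) (hκ : 0 < κ) (hn : hashDomain c κ d k ^ 3 ≤ 2 ^ (n + 1))
    (p q : Fin d → ℚ) : ((badSeeds c κ k n p q).card : ℝ) ≤
      Fintype.card (Fin 4 → ZMod (2 ^ (n + 1))) * (200 / κ) := by
  have hk' : (0 : ℝ) < k := by exact_mod_cast hk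
  have hκ' : (0 : ℝ) < κ := by exact_mod_cast hκ
  have h := card_bad_seeds_le (K := repCount κ k)
    (fun (s : Fin 4 → ZMod (2 ^ (n + 1))) r (a : Fin d × Fin (gridSize c d k ^ 2)) =>
      hashSign s (hashCode c κ d k a.1 a.2 r)) (embedDiff c k p q) (η := 1 / (10 * k))
    (by positivity) (by unfold repCount; positivity) (fun s r a => hashSign_mul_self s _)
    (fun x y z w hxy hxz hxw => by
      have lt (x : Fin (repCount κ k) × Fin d × Fin (gridSize c d k ^ 2)) :=
        hashCode_lt (c := c) (κ := κ) x.2.1.2 x.2.2.2 x.1.2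
      have inj {x y : Fin (repCount κ k) × Fin d × Fin (gridSize c d k ^ 2)} (h : x ≠ y) :
          hashCode c κ d k x.2.1 x.2.2 x.1 ≠ hashCode c κ d k y.2.1 y.2.2 y.1 := fun he => by
        obtain ⟨h1, h2, h3⟩ := hashCode_inj x.2.2.2 x.1.2 y.2.2.2 y.1.2 he
        exact h (Prod.ext (Fin.ext h3) (Prod.ext (Fin.ext h1) (Fin.ext h2)))
      exact sum_hashSign_mul_eq_zero hn (lt x) (lt y) (lt z) (lt w) (inj hxy) (inj hxz) (inj hxw))
    (badSeeds c κ k n p q) (fun s hs => (Finset.mem_filter.1 hs).2)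
  refine h.trans_eq ?_
  unfold repCount
  push_cast
  field_simp
  norm_num

/-- The squared norm of the embedding of `1`, which normalizes the estimate. -/
def embedNorm (c d k : ℕ) : ℕ := ∑ j ∈ Finset.range (gridSize c d k ^ 2),
  embed (gridSize c d k ^ 3) (gridSize c d k ^ 2) j (gridSize c d k) ^ 2

lemma abs_embedNorm_sub_le (hd : 0 < d) (hk : 0 < k) :
    |(embedNorm c d k : ℝ) - embedScale (gridSize c d k)| ≤
      1 / (10 * k) * embedScale (gridSize c d k) := by
  have h := abs_embedDist_sub_jsTerm_le_mul (c := c) hd hk rfl (x := 1) (y := 0) (by norm_num)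
    le_rfl le_rfl (by norm_num) (by simpa using Nat.one_le_pow _ _ hd)
    (by simpa using Nat.one_le_pow _ _ hd)
  have e : embedDist (gridSize c d k ^ 3) (gridSize c d k ^ 2) (gridIndex (gridSize c d k) 1)
      (gridIndex (gridSize c d k) 0) = embedNorm c d k := by
    simp [embedDist, embedNorm, gridIndex, embed]
  rw [e] at h
  simpa [jsTerm_one_zero] using h

lemma le_one_of_mem_stdSimplex {p : Fin d → ℚ} (hp : p ∈ stdSimplex ℚ (Fin d)) (i : Fin d) :
    p i ≤ 1 :=
  hp.2 ▸ Finset.single_le_sum (fun j _ => hp.1 j) (Finset.mem_univ i)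

lemma abs_sum_embedDiff_sq_sub_le (hd : 0 < d) (hk : 0 < k) {p q : Fin d → ℚ}
    (hp : p ∈ stdSimplex ℚ (Fin d)) (hq : q ∈ stdSimplex ℚ (Fin d))
    (hpc : ∀ i, (p i).den ≤ d ^ c) (hqc : ∀ i, (q i).den ≤ d ^ c) :
    |∑ a, embedDiff c k p q a ^ 2 - embedScale (gridSize c d k) *
        jsDiv (fun i => (p i : ℝ)) fun i => (q i : ℝ)| ≤
      1 / (10 * k) * (embedScale (gridSize c d k) *
        jsDiv (fun i => (p i : ℝ)) fun i => (q i : ℝ)) := by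
  have ej : jsDiv (fun i => (p i : ℝ)) (fun i => (q i : ℝ)) = ∑ i, jsTerm (p i) (q i) := rfl
  rw [sum_embedDiff_sq, ej, Finset.mul_sum, Finset.mul_sum, ← Finset.sum_sub_distrib]
  refine (Finset.abs_sum_le_sum_abs _ _).trans (Finset.sum_le_sum fun i _ => ?_)
  exact abs_embedDist_sub_jsTerm_le_mul hd hk rfl (hp.1 i) (hq.1 i)
    (le_one_of_mem_stdSimplex hp i) (le_one_of_mem_stdSimplex hq i) (hpc i) (hqc i)

lemma jsDiv_nonneg {p q : Fin d → ℚ} (hp : p ∈ stdSimplex ℚ (Fin d))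
    (hq : q ∈ stdSimplex ℚ (Fin d)) : 0 ≤ jsDiv (fun i => (p i : ℝ)) fun i => (q i : ℝ) := by
  have le_one {p : Fin d → ℚ} (hp : p ∈ stdSimplex ℚ (Fin d)) (i : Fin d) : (p i : ℝ) ≤ 1 := by
    exact_mod_cast le_one_of_mem_stdSimplex hp i
  exact Finset.sum_nonneg fun i _ => jsTerm_nonneg (Rat.cast_nonneg.2 (hp.1 i))
    (Rat.cast_nonneg.2 (hq.1 i)) (le_one hp i) (le_one hq i)

lemma ratio_bounds {E K N J v t η ε : ℝ} (hη : 0 < η) (hη' : η ≤ ε / 10) (hε : ε ≤ 1 / 2)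
    (hK : 0 < K) (ht : 0 < t) (hJ : 0 ≤ J) (h1 : |E - K * v| ≤ η * (K * v))
    (h2 : |v - t * J| ≤ η * (t * J)) (h3 : |N - t| ≤ η * t) :
    J ≤ (1 + ε) * (E / (K * N)) ∧ E / (K * N) ≤ (1 + ε) * J := by
  rw [abs_le] at h1 h2 h3
  have hη1 : η ≤ 1 / 20 := by linarith
  have hN : 0 < N := by nlinarith
  have htJ : 0 ≤ t * J := by positivity
  have lo : K * ((1 - η) ^ 2 * (t * J)) ≤ E := by
    calc K * ((1 - η) ^ 2 * (t * J)) = (1 - η) * (K * ((1 - η) * (t * J))) := by ring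
      _ ≤ (1 - η) * (K * v) := by
        have : (1 - η) * (t * J) ≤ v := by linarith
        have : 0 ≤ 1 - η := by linarith
        gcongr
      _ ≤ E := by linarith
  have hi : E ≤ K * ((1 + η) ^ 2 * (t * J)) := by
    calc E ≤ (1 + η) * (K * v) := by linarith
      _ ≤ (1 + η) * (K * ((1 + η) * (t * J))) := by
        have : v ≤ (1 + η) * (t * J) := by linarith
        gcongr
      _ = _ := by ring
  have a1 : 1 + η ≤ (1 + ε) * (1 - η) ^ 2 := by
    have : (1 + 10 * η) * (1 - η) ^ 2 ≤ (1 + ε) * (1 - η) ^ 2 := by gcongr; linarith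
    nlinarith [mul_pos hη hη, mul_pos (mul_pos hη hη) hη]
  have a2 : (1 + η) ^ 2 ≤ (1 + ε) * (1 - η) := by
    have : (1 + 10 * η) * (1 - η) ≤ (1 + ε) * (1 - η) := by gcongr <;> linarith
    nlinarith
  have hε0 : 0 < 1 + ε := by linarith
  constructor
  · rw [← mul_div_assoc, le_div_iff₀ (by positivity)]
    calc J * (K * N) ≤ J * (K * ((1 + η) * t)) := by gcongr; linarith
      _ = K * (t * J) * (1 + η) := by ring
      _ ≤ K * (t * J) * ((1 + ε) * (1 - η) ^ 2) := by gcongr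
      _ = (1 + ε) * (K * ((1 - η) ^ 2 * (t * J))) := by ring
      _ ≤ (1 + ε) * E := by gcongr
  · rw [div_le_iff₀ (by positivity)]
    calc E ≤ K * ((1 + η) ^ 2 * (t * J)) := hi
      _ = K * (t * J) * (1 + η) ^ 2 := by ring
      _ ≤ K * (t * J) * ((1 + ε) * (1 - η)) := by gcongr
      _ = (1 + ε) * J * (K * ((1 - η) * t)) := by ring
      _ ≤ (1 + ε) * J * (K * N) := by gcongr; linarith

end Accuracy

/-! ### Space -/

/-- A bound for the contents of all cells. -/
def valueBound (c κ d k : ℕ) : ℕ := (2 * d * gridSize c d k * repCount κ k) ^ 13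

lemma ample_valueBound {c κ d k : ℕ} (hd : 0 < d) (hk : 0 < k) (hκ : 0 < κ) :
    Ample c κ d k (valueBound c κ d k) := by
  have hM : 0 < gridSize c d k := gridSize_pos hd hk
  have hK : 0 < repCount κ k := by unfold repCount; positivity
  have hkK : k ≤ repCount κ k := by
    unfold repCount
    calc k = 1 * (k * 1) := by ring
      _ ≤ κ * (k * k) := by gcongr <;> omega
      _ = _ := by ring
  have hcM : d ^ c ≤ gridSize c d k := by
    unfold gridSize
    calc d ^ c ≤ d ^ (4 * c) := Nat.pow_le_pow_right hd (by omega)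
      _ ≤ 2400 * k * d ^ (4 * c) := Nat.le_mul_of_pos_left _ (by positivity)
      _ ≤ _ := Nat.le_self_pow (by norm_num) _
  unfold valueBound
  have hD : hashDomain c κ d k = d * gridSize c d k ^ 2 * repCount κ k := rfl
  set M := gridSize c d k
  set K := repCount κ k
  generalize hQ : 2 * d * M * K = Q
  have h1 : 1 ≤ Q := by rw [← hQ]; exact Nat.succ_le_of_lt (by positivity)
  have le2d : 2 * d ≤ Q := hQ ▸ (by
    calc 2 * d = 2 * d * 1 * 1 := by ring
      _ ≤ _ := by gcongr <;> omega)
  have leM : M ≤ Q := hQ ▸ (by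
    calc M = 1 * M * 1 := by ring
      _ ≤ _ := by gcongr <;> omega)
  have leK : K ≤ Q := hQ ▸ Nat.le_mul_of_pos_left _ (by positivity)
  have up {x : ℕ} (e : ℕ) (he : e ≤ 13) (h : x ≤ Q ^ e) : x ≤ Q ^ 13 :=
    h.trans (Nat.pow_le_pow_right h1 he)
  have hd' : d ≤ Q := by omega
  have dmk : d * M * K ≤ Q := hQ ▸ (by gcongr; omega)
  have sk : 2 * d * (M ^ 2 * (M ^ 3 * M)) ≤ Q ^ 6 := by
    calc 2 * d * (M ^ 2 * (M ^ 3 * M)) = (2 * d * M * 1) * M ^ 5 := by ring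
      _ ≤ (2 * d * M * K) * Q ^ 5 := by gcongr; omega
      _ = Q ^ 6 := by rw [hQ]; ring
  have up₁ {x : ℕ} (h : x ≤ Q) : x ≤ Q ^ 13 := h.trans (Nat.le_self_pow (by norm_num) Q)
  refine ⟨up₁ h1, up₁ hd', up₁ (hkK.trans leK), up₁ (hcM.trans leM), up₁ leM,
    up 2 (by norm_num) (Nat.pow_le_pow_left leM 2), up 3 (by norm_num) (Nat.pow_le_pow_left leM 3),
    up 4 (by norm_num) ?_, up₁ leK, up 6 (by norm_num) ?_, up 6 (by norm_num) sk, up 13 le_rfl ?_,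
    up 10 (by norm_num) ?_, up 11 (by norm_num) ?_⟩
  · calc M ^ 3 * M = M ^ 4 := by ring
      _ ≤ Q ^ 4 := by gcongr
  · calc 2 * hashDomain c κ d k ^ 3 = (2 * d * M * K) * (d * M * K) ^ 2 * M ^ 3 := by rw [hD]; ring
      _ ≤ Q * Q ^ 2 * Q ^ 3 := by rw [hQ]; gcongr
      _ = Q ^ 6 := by ring
  · calc _ ≤ Q * (Q ^ 6) ^ 2 := Nat.mul_le_mul leK (Nat.pow_le_pow_left sk 2)
      _ = Q ^ 13 := by ring
  · calc M ^ 2 * (M ^ 3 * M) ^ 2 = M ^ 10 := by ring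
      _ ≤ Q ^ 10 := by gcongr
  · calc K * (M ^ 2 * (M ^ 3 * M) ^ 2) = K * M ^ 10 := by ring
      _ ≤ Q * Q ^ 10 := by gcongr
      _ = Q ^ 11 := by ring

lemma size_le_log {n : ℕ} (hn : 0 < n) : (n.size : ℝ) ≤ 1 + 2 * Real.log n := by
  obtain ⟨t, ht⟩ : ∃ t, n.size = t + 1 := Nat.exists_eq_succ_of_ne_zero (Nat.size_pos.2 hn).ne'
  have h1 : 2 ^ t ≤ n := Nat.lt_size.1 (by omega)
  have h2 : (t : ℝ) * Real.log 2 ≤ Real.log n := by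
    rw [← Real.log_pow]
    exact Real.log_le_log (by positivity) (by exact_mod_cast h1)
  have h3 := Real.log_two_gt_d9
  rw [ht]
  push_cast
  nlinarith [Nat.cast_nonneg (α := ℝ) t]

/-- The number of bits needed, up to the factor `1 / ε ^ 2 * log (1 / ε) * log d`. -/
noncomputable def spaceConst (c κ : ℕ) : ℝ :=
  (8 + 8 * κ) * (2 * (4 + 26 * (4 * Real.log (2 * 2400 ^ 2 * κ) + 16 + 2 * (8 * c + 1))))

lemma spaceConst_pos (c : ℕ) {κ : ℕ} (hκ : 0 < κ) : 0 < spaceConst c κ := by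
  have hκ' : (1 : ℝ) ≤ κ := by exact_mod_cast hκ
  have : 0 ≤ Real.log (2 * 2400 ^ 2 * κ) := Real.log_nonneg (by linarith)
  unfold spaceConst
  positivity

lemma suffices_spaceConst (c : ℕ) {κ d : ℕ} {ε : ℝ} (hκ : 0 < κ) (hd : 2 ≤ d) (hε : 0 < ε)
    (hε' : ε ≤ 1 / 2) :
    Suffices (32 + 2 * repCount κ ⌈1 / ε⌉₊) (valueBound c κ d ⌈1 / ε⌉₊)
      (spaceConst c κ * (1 / ε ^ 2 * Real.log (1 / ε) * Real.log d)) := by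
  intro m hm
  have hinv : 2 ≤ 1 / ε := by rw [le_div_iff₀ hε]; linarith
  set k := ⌈1 / ε⌉₊ with hk
  have hk0 : 0 < k := Nat.ceil_pos.2 (by positivity)
  have hkle : (k : ℝ) ≤ 2 / ε := by
    have := Nat.ceil_lt_add_one (a := 1 / ε) (by positivity)
    have e : 2 / ε = 1 / ε + 1 / ε := by ring
    rw [e]; linarith
  set x := Real.log d with hx
  set y := Real.log (1 / ε) with hy
  have hlog2 := Real.log_two_gt_d9
  have hx2 : 1 / 2 ≤ x := by
    have : Real.log 2 ≤ x := Real.log_le_log (by norm_num) (by exact_mod_cast hd)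
    linarith
  have hy2l : Real.log 2 ≤ y := Real.log_le_log (by norm_num) hinv
  have hy2 : 1 / 2 ≤ y := by linarith
  have hlogk : Real.log k ≤ 2 * y := by
    have h1 : Real.log k ≤ Real.log (2 * (1 / ε)) :=
      Real.log_le_log (by positivity) (by rw [mul_one_div]; exact hkle)
    rw [Real.log_mul (by norm_num) (by positivity)] at h1
    linarith
  have hκ' : (1 : ℝ) ≤ κ := by exact_mod_cast hκ
  set a := Real.log (2 * 2400 ^ 2 * κ) with ha
  have ha0 : 0 ≤ a := Real.log_nonneg (by linarith)
  set Q := 2 * d * gridSize c d k * repCount κ k with hQdef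
  have hQ : (Q : ℝ) = (2 * 2400 ^ 2 * κ) * (k : ℝ) ^ 4 * (d : ℝ) ^ (8 * c + 1) := by
    rw [hQdef]; unfold gridSize repCount; push_cast; ring
  have hd0 : (0 : ℝ) < d := by positivity
  have hk0' : (0 : ℝ) < k := by positivity
  have hlogQ : Real.log Q ≤ (4 * a + 16 + 2 * (8 * c + 1)) * (x * y) := by
    rw [hQ, Real.log_mul (by positivity) (by positivity), Real.log_mul (by positivity)
      (by positivity), Real.log_pow, Real.log_pow]
    push_cast
    have b1 : 1 ≤ 4 * (x * y) := by nlinarith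
    have b2 : y ≤ 2 * (x * y) := by nlinarith
    have b3 : x ≤ 2 * (x * y) := by nlinarith
    have c1 : a * 1 ≤ a * (4 * (x * y)) := by gcongr
    have c3 : (8 * c + 1 : ℝ) * x ≤ (8 * c + 1) * (2 * (x * y)) := by gcongr
    linarith
  have hQ0 : 0 < Q := by
    have : (0 : ℝ) < Q := by rw [hQ]; positivity
    exact_mod_cast this
  have hV0 : 0 < valueBound c κ d k := by unfold valueBound; positivity
  have hAV : 32 + 2 * repCount κ k ≤ valueBound c κ d k := by
    have hK : 0 < repCount κ k := by unfold repCount; positivity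
    have h1 : 32 + 2 * repCount κ k ≤ Q := by
      have hM : 17 ≤ gridSize c d k := by
        have : 1 ≤ k * d ^ (4 * c) := Nat.succ_le_of_lt (by positivity)
        unfold gridSize
        rw [mul_assoc]
        nlinarith
      calc 32 + 2 * repCount κ k ≤ 2 * 1 * 17 * repCount κ k := by omega
        _ ≤ Q := by rw [hQdef]; gcongr; omega
    exact h1.trans (Nat.le_self_pow (by norm_num) _)
  have hsize : ((valueBound c κ d k).size : ℝ) ≤
      (4 + 26 * (4 * a + 16 + 2 * (8 * c + 1))) * (x * y) := by
    refine (size_le_log hV0).trans ?_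
    have : Real.log (valueBound c κ d k) = 13 * Real.log Q := by
      unfold valueBound; rw [← hQdef]; push_cast; rw [Real.log_pow]; norm_num
    rw [this]
    have b1 : 1 ≤ 4 * (x * y) := by nlinarith
    linarith
  have hA : ((32 + 2 * repCount κ k : ℕ) : ℝ) ≤ (8 + 8 * κ) * (1 / ε ^ 2) := by
    have h1 : (4 : ℝ) ≤ 1 / ε ^ 2 := by
      rw [← one_div_pow]; nlinarith
    have h2 : (k : ℝ) ^ 2 ≤ 4 * (1 / ε ^ 2) := by
      calc (k : ℝ) ^ 2 ≤ (2 / ε) ^ 2 := by gcongr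
        _ = _ := by rw [div_pow]; ring
    unfold repCount
    push_cast
    have h3 : (κ : ℝ) * k ^ 2 ≤ κ * (4 * (1 / ε ^ 2)) := by gcongr
    linarith
  have hs := hm.space_le
  have hs' : (m.space : ℝ) ≤ ((32 + 2 * repCount κ k : ℕ) : ℝ) *
      (2 * (valueBound c κ d k).size) := by
    refine (Nat.cast_le.2 hs).trans ?_
    push_cast
    have : ((32 + 2 * repCount κ k).size : ℝ) ≤ (valueBound c κ d k).size := by
      exact_mod_cast Nat.size_le_size hAV
    gcongr
    linarith
  refine hs'.trans ?_
  calc _ ≤ (8 + 8 * κ) * (1 / ε ^ 2) *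
        (2 * ((4 + 26 * (4 * a + 16 + 2 * (8 * c + 1))) * (x * y))) := by gcongr
    _ = _ := by unfold spaceConst; ring

section Main

variable {c κ d k n : ℕ}

lemma startMem_bounded {A V : ℕ} (hA : 2 ≤ A) (hd : d ≤ V) (hk : k ≤ V) :
    Bounded A V (startMem d k) where
  le a := by
    simp only [startMem, Finsupp.add_apply, Finsupp.single_apply]
    split_ifs <;> omega
  zero a ha := by
    simp only [startMem, Finsupp.add_apply, Finsupp.single_apply]
    rw [if_neg (by omega), if_neg (by omega), add_zero]

lemma IsAggregateStream.length_eq {p q : Fin d → ℚ} {l : List (Item d)}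
    (h : IsAggregateStream p q l) : l.length = 2 * d := by
  rw [List.Perm.length_eq h]; simp [two_mul]

lemma IsAggregateStream.valid {p q : Fin d → ℚ} {l : List (Item d)}
    (h : IsAggregateStream p q l) (hp : p ∈ stdSimplex ℚ (Fin d)) (hq : q ∈ stdSimplex ℚ (Fin d))
    (hpc : ∀ i, (p i).den ≤ d ^ c) (hqc : ∀ i, (q i).den ≤ d ^ c) : ∀ x ∈ l, x.Valid c := by
  intro x hx
  have := h.mem_iff.1 hx
  simp only [List.mem_append, List.mem_map, List.mem_finRange, true_and] at this
  rcases this with ⟨i, rfl⟩ | ⟨i, rfl⟩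
  · exact ⟨hp.1 i, le_one_of_mem_stdSimplex hp i, hpc i⟩
  · exact ⟨hq.1 i, le_one_of_mem_stdSimplex hq i, hqc i⟩

lemma memSqDiff_cast (m : Mem) (r : ℕ) :
    (memSqDiff m r : ℝ) = ((m (32 + 2 * r + 0) : ℝ) - m (32 + 2 * r + 1)) ^ 2 := by
  unfold memSqDiff
  rw [add_zero]
  rcases le_total (m (32 + 2 * r)) (m (32 + 2 * r + 1)) with h | h
  · rw [Nat.sub_eq_zero_of_le h]; push_cast [h]; ring
  · rw [Nat.sub_eq_zero_of_le h]; push_cast [h]; ring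

/-- For all outcomes of the coin tosses, the algorithm outputs the normalized energy of the
sketch. -/
lemma algorithm_outputs (hd : 0 < d) (hk : 0 < k) (hκ : 0 < κ) {S : ℝ}
    (hS : Suffices (32 + 2 * repCount κ k) (valueBound c κ d k) S)
    (hn : Nat.clog 2 (hashDomain c κ d k ^ 3) = n + 1) {p q : Fin d → ℚ}
    (hp : p ∈ stdSimplex ℚ (Fin d)) (hq : q ∈ stdSimplex ℚ (Fin d))
    (hpc : ∀ i, (p i).den ≤ d ^ c) (hqc : ∀ i, (q i).den ≤ d ^ c) {l : List (Item d)}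
    (hl : IsAggregateStream p q l) (ω : ℕ → Bool) :
    ∃ r : ℚ, (algorithm c κ).Outputs S k l ω r ∧
      (r : ℝ) = sketchEnergy c κ k p q (seeds (n + 1) ω) / (repCount κ k * embedNorm c d k) := by
  have hV := ample_valueBound (c := c) hd hk hκ
  obtain ⟨m₁, ω₁, r₁, s₁, z₁⟩ := runs_initProg hV (A := 32 + 2 * repCount κ k) (by omega) ω
    (startMem_bounded (by omega) hV.dim hV.par) (by simp [startMem]) (by simp [startMem])
    (fun a ha => by
      simp only [startMem, Finsupp.add_apply, Finsupp.single_apply]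
      rw [if_neg (by omega), if_neg (by omega), add_zero])
  rw [hn] at s₁
  have hvalid := hl.valid hp hq hpc hqc
  obtain ⟨m₂, p₂, s₂, k₂⟩ := pass_updateProg hV rfl l hvalid s₁ (fun r hr b hb => by
    rw [z₁ _ (by omega), hl.length_eq, zero_add]
    exact hV.sketch)
  have k₂' : ∀ r < repCount κ k, ∀ b < 2, m₂ (32 + 2 * r + b) =
      (l.map (contribution c κ k (seeds (n + 1) ω) r b)).sum := fun r hr b hb => by
    rw [k₂ r hr b hb, z₁ _ (by omega), zero_add]
  obtain ⟨m₃, r₃, h0, h1⟩ := ensures_finishProg hV rfl s₂.bounded s₂.dim s₂.par fun r hr b hb => by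
    rw [k₂' r hr b hb, ← hl.length_eq, ← smul_eq_mul]
    refine (List.sum_le_card_nsmul _ _ ?_).trans_eq (by rw [List.length_map])
    intro y hy
    obtain ⟨x, hx, rfl⟩ := List.mem_map.1 hy
    exact contribution_le _ r b (hvalid x hx)
  have hN : 0 < embedNorm c d k := by
    have h := (abs_le.1 (abs_embedNorm_sub_le (c := c) hd hk)).1
    have hs := embedScale_pos (gridSize_pos (c := c) hd hk)
    have h10 : 1 / (10 * k : ℝ) ≤ 1 / 10 := by
      have : (1 : ℝ) ≤ k := by exact_mod_cast hk
      gcongr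
      linarith
    have : (0 : ℝ) < embedNorm c d k := by nlinarith
    exact_mod_cast this
  have hK : 0 < repCount κ k := by unfold repCount; positivity
  refine ⟨(m₃ 0 : ℚ) / (m₃ 1 : ℚ), ⟨⟨m₁, ω₁⟩, ⟨m₂, ω₁⟩, ⟨m₃, ω₁⟩, r₁ S hS, p₂ S hS ω₁, r₃ ω₁ S hS,
    ?_, rfl⟩, ?_⟩
  · change m₃ 1 ≠ 0
    rw [h1]
    exact (Nat.mul_pos hK hN).ne'
  · rw [h0, h1]
    push_cast
    congr 1
    · rw [Finset.sum_range]
      refine Finset.sum_congr rfl fun r _ => ?_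
      rw [memSqDiff_cast, k₂' r r.2 0 (by norm_num), k₂' r r.2 1 (by norm_num), sketch_sub hl]
    · unfold embedNorm
      push_cast
      rfl

end Main

end JSStream

theorem mainTheorem4 (c : ℕ) (δ : ℝ) (hδ : 0 < δ) :
    ∃ (A : JSStream.Algorithm) (C : ℝ), 0 < C ∧
      ∀ (d : ℕ), 2 ≤ d → ∀ (ε : ℝ), 0 < ε → ε ≤ 1 / 2 →
      ∀ (p q : Fin d → ℚ), p ∈ stdSimplex ℚ (Fin d) → q ∈ stdSimplex ℚ (Fin d) →
      (∀ i, (p i).den ≤ d ^ c) → (∀ i, (q i).den ≤ d ^ c) →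
      ∀ (l : List (JSStream.Item d)), JSStream.IsAggregateStream p q l →
        (∀ ω : ℕ → Bool, ∃ r : ℚ,
          A.Outputs (C * (1 / ε ^ 2 * Real.log (1 / ε) * Real.log d)) ⌈1 / ε⌉₊ l ω r) ∧
        JSStream.coinMeasure
          {ω | ¬ ∃ r : ℚ,
            A.Outputs (C * (1 / ε ^ 2 * Real.log (1 / ε) * Real.log d)) ⌈1 / ε⌉₊ l ω r ∧
            JSStream.jsDiv (fun i => (p i : ℝ)) (fun i => (q i : ℝ)) ≤ (1 + ε) * (r : ℝ) ∧
            (r : ℝ) ≤ (1 + ε) * JSStream.jsDiv (fun i => (p i : ℝ)) (fun i => (q i : ℝ))}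
          ≤ ENNReal.ofReal δ := by
  obtain ⟨κ, hκ⟩ : ∃ κ : ℕ, κ = ⌈200 / δ⌉₊ := ⟨_, rfl⟩
  have hκ0 : 0 < κ := hκ ▸ Nat.ceil_pos.2 (by positivity)
  refine ⟨JSStream.algorithm c κ, JSStream.spaceConst c κ, JSStream.spaceConst_pos c hκ0, ?_⟩
  intro d hd ε hε hε' p q hp hq hpc hqc l hl
  have hS := JSStream.suffices_spaceConst c hκ0 hd hε hε'
  have hk1 : 1 / ε ≤ ⌈1 / ε⌉₊ := Nat.le_ceil _
  have hk : 0 < ⌈1 / ε⌉₊ := Nat.ceil_pos.2 (by positivity)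
  generalize ⌈1 / ε⌉₊ = k at *
  have hd0 : 0 < d := by omega
  obtain ⟨n, hn⟩ : ∃ n, Nat.clog 2 (JSStream.hashDomain c κ d k ^ 3) = n + 1 := by
    refine Nat.exists_eq_succ_of_ne_zero (Nat.clog_pos (by norm_num) ?_).ne'
    have h1 : 2 ≤ JSStream.hashDomain c κ d k := by
      have h2 : 0 < JSStream.gridSize c d k ^ 2 * JSStream.repCount κ k := by
        have := JSStream.gridSize_pos (c := c) hd0 hk
        unfold JSStream.repCount
        positivity
      unfold JSStream.hashDomain
      rw [mul_assoc]
      exact hd.trans (Nat.le_mul_of_pos_right d h2)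
    exact h1.trans (Nat.le_self_pow (by norm_num) _)
  have out := JSStream.algorithm_outputs hd0 hk hκ0 hS hn hp hq hpc hqc hl
  refine ⟨fun ω => (out ω).imp fun r hr => hr.1, ?_⟩
  have hbad := JSStream.card_badSeeds_le (c := c) (n := n) hk hκ0
    (hn ▸ Nat.le_pow_clog (by norm_num) _) p q
  have hδκ : 200 / (κ : ℝ) ≤ δ := by
    have h1 : 200 / δ ≤ κ := hκ ▸ Nat.le_ceil _
    rw [div_le_iff₀ hδ] at h1
    rw [div_le_iff₀ (by exact_mod_cast hκ0)]
    linarith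
  refine (measure_mono fun ω hω => ?_).trans (JSStream.coinMeasure_seeds_mem_le (n + 1)
    (JSStream.badSeeds c κ k n p q) (hbad.trans (by gcongr)))
  by_contra hgood
  refine hω ?_
  obtain ⟨r, hr, hr'⟩ := out ω
  refine ⟨r, hr, ?_⟩
  have hg : |JSStream.sketchEnergy c κ k p q (JSStream.seeds (n + 1) ω) -
      JSStream.repCount κ k * ∑ a, JSStream.embedDiff c k p q a ^ 2| ≤
      1 / (10 * k) * (JSStream.repCount κ k * ∑ a, JSStream.embedDiff c k p q a ^ 2) := by
    by_contra h
    exact hgood (Finset.mem_filter.2 ⟨Finset.mem_univ _, not_le.1 h⟩)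
  rw [hr']
  have hk' : (0 : ℝ) < k := by exact_mod_cast hk
  have hη : 1 / (10 * k : ℝ) ≤ ε / 10 := by
    rw [div_le_iff₀ hε] at hk1
    rw [div_le_div_iff₀ (by positivity) (by norm_num)]
    linarith
  have hK : (0 : ℝ) < JSStream.repCount κ k := by
    have : 0 < JSStream.repCount κ k := by unfold JSStream.repCount; positivity
    exact_mod_cast this
  exact JSStream.ratio_bounds (by positivity) hη hε' hK
    (JSStream.embedScale_pos (JSStream.gridSize_pos hd0 hk)) (JSStream.jsDiv_nonneg hp hq) hg
    (JSStream.abs_sum_embedDiff_sq_sub_le hd0 hk hp hq hpc hqc)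
    (JSStream.abs_embedNorm_sub_le hd0 hk)
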